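/- Write $I=[0,1]$ with Lebesgue measure and $\mathbb N^{(2)}=\{(i,j)\in\mathbb N^2: i<j\}$. A kernel is a measurable function $W:I^2\to[-1,1]$ with $W(x,y)=W(y,x)$ for a.e. $(x,y)$. The cut norm of a bounded measurable function $W$ on $I^2$ is $\|W\|_\square=\sup_{S,T}\left|\int_{S\times T}W\right|$, the supremum being over measurable $S,T\subseteq I$. Two kernels $W_1,W_2$ are weakly isomorphic if there are a bounded measurable function $W$ on $I^2$, symmetric a.e., and measure preserving maps $\varphi_1,\varphi_2:I\to I$ with $W_i(x,y)=W(\varphi_i(x),\varphi_i(y))$ for a.e. $(x,y)$, $i=1,2$. A graphon $[W]$ is a class of kernels modulo weak isomorphism, and graphons carry the cut metric $$\delta_\square([W_1],[W_2])=\inf_{\varphi,\psi}\big\|W_1(\varphi(\cdot),\varphi(\cdot))-W_2(\psi(\cdot),\psi(\cdot))\big\|_\square$$ (the infimum being over measure preserving $\varphi,\psi:I\to I$) and its Borel $\sigma$-algebra. For an array $a=(a_{i,j})_{i<j}$ with entries in $[-1,1]$, let $K_n(a)$ be the graphon of the step function on $I^2$ that corresponds to the symmetric $n\times n$ matrix with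 off-diagonal entries $a_{i,j}$ and zero diagonal, where $I$ is divided into $n$ consecutive intervals of equal length. Let $\zeta=(\zeta_{i,j})_{(i,j)\in\mathbb N^{(2)}}$ be a $[-1,1]$-valued exchangeable symmetric array (its law is invariant under finite permutations of $\mathbb N$) that is directed by a measurable function $f:I\times I^2\times I\to[-1,1]$: there are i.i.d. uniform $[0,1]$ random variables $U$, $(U_i)_{i\in\mathbb N}$, $(U_{i,j})_{i<j}$ such that, almost surely, for all $i<j$, $$\zeta_{i,j}=f(U,U_i,U_j,U_{i,j})=f(U,U_j,U_i,U_{i,j}).$$ Set $g_u(x,y)=\mathbb E f(u,x,y,V)$ with $V$ uniform on $[0,1]$. Then the following hold. 1. For almost every $u\in I$, $g_u$ is a kernel. 2. For every $u\in I$ for which $g_u$ is a kernel (hence for almost every $u$), almost surely $$\lim_{n\to\infty}\delta_\square\Big(K_n\big((f(u,U_i,U_j,U_{i,j}))_{i<j}\big),[g_u]\Big)=0 .$$ Moreover, for almost every $u$, $\lim_{n\to\infty}\delta_\square(K_n(\zeta),[g_u])=0$ almost surely under the regular conditional law of $\zeta$ given $U=u$. 3. $[g_U]$ is a random graphon, that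 is, a measurable map into the space of graphons (on the null set where $g_U$ is not a kernel, $[g_U]$ is set to be the graphon $[0]$). 4. The law of $[g_U]$ does not depend on the choice of $f$: if $\zeta'$ is an array with the same law as $\zeta$, possibly on another probability space, and $\zeta'$ is directed by $f'$ by means of i.i.d. uniform variables $U',(U'_i),(U'_{i,j})$, then $[g'_{U'}]$, where $g'_u(x,y)=\mathbb E f'(u,x,y,V)$, has the same law as $[g_U]$. -/

import Mathlib

open MeasureTheory ProbabilityTheory Filter Topology
open scoped unitInterval

namespace RandomGraphon

/-! ## Kernels on the unit square, the cut norm and weak isomorphism -/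

/-- The set `𝒮` of bounded measurable functions on `[0,1]²` that are symmetric a.e. -/
structure IsBoundedSymm (W : I → I → ℝ) : Prop where
  measurable : Measurable fun p : I × I => W p.1 p.2
  bounded : ∃ C : ℝ, ∀ x y, |W x y| ≤ C
  symm : ∀ᵐ p : I × I, W p.1 p.2 = W p.2 p.1

/-- The set `𝒲` of kernels: the elements of `𝒮` with values in `[-1,1]`. -/
structure IsKernel (W : I → I → ℝ) : Prop extends IsBoundedSymm W where
  mem_Icc : ∀ x y, W x y ∈ Set.Icc (-1 : ℝ) 1

/-- The type of kernels. -/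
def SymmKernel : Type := {W : I → I → ℝ // IsKernel W}

/-- The cut norm: the supremum of `|∫_{S × T} W|` over measurable `S, T ⊆ [0,1]`. -/
noncomputable def cutNorm (W : I → I → ℝ) : ℝ :=
  sSup {r : ℝ | ∃ S T : Set I, MeasurableSet S ∧ MeasurableSet T ∧
    r = |∫ p in S ×ˢ T, W p.1 p.2|}

/-- The distance `inf_{φ, ψ} ‖W₁^φ - W₂^ψ‖` in the cut norm, over measure preserving maps
`φ, ψ : [0,1] → [0,1]`, where `W^φ (x, y) = W (φ x, φ y)`. -/
noncomputable def cutDist (W₁ W₂ : SymmKernel) : ℝ :=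
  sInf {r : ℝ | ∃ φ ψ : I → I, MeasurePreserving φ ∧ MeasurePreserving ψ ∧
    r = cutNorm fun x y => W₁.1 (φ x) (φ y) - W₂.1 (ψ x) (ψ y)}

/-- Weak isomorphism `W₁ ≅ W₂`: both are a.e. equal to pullbacks of one element of `𝒮`. -/
def WeakIso (W₁ W₂ : SymmKernel) : Prop :=
  ∃ W : I → I → ℝ, IsBoundedSymm W ∧
    ∃ φ₁ φ₂ : I → I, MeasurePreserving φ₁ ∧ MeasurePreserving φ₂ ∧
      (∀ᵐ p : I × I, W₁.1 p.1 p.2 = W (φ₁ p.1) (φ₁ p.2)) ∧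
      (∀ᵐ p : I × I, W₂.1 p.1 p.2 = W (φ₂ p.1) (φ₂ p.2))

/-- The space of graphons: kernels modulo weak isomorphism. -/
def Graphon : Type := Quot WeakIso

/-- The graphon `[W]` of a kernel. -/
def SymmKernel.toGraphon (W : SymmKernel) : Graphon := Quot.mk WeakIso W

/-! ## The cut distance is a pseudometric that descends to graphons -/

theorem bddAbove_cutNorm {W : I → I → ℝ} {C : ℝ} (hb : ∀ x y, |W x y| ≤ C) :
    BddAbove {r : ℝ | ∃ S T : Set I, MeasurableSet S ∧ MeasurableSet T ∧
      r = |∫ p in S ×ˢ T, W p.1 p.2|} := by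
  refine ⟨C, ?_⟩
  rintro r ⟨S, T, -, -, rfl⟩
  have h := norm_setIntegral_le_of_norm_le_const (μ := (volume : Measure (I × I)))
    (s := S ×ˢ T) (f := fun p : I × I => W p.1 p.2) (C := C)
    (measure_lt_top _ _) (fun p _ => by simpa [Real.norm_eq_abs] using hb p.1 p.2)
  rw [Real.norm_eq_abs] at h
  have hC : 0 ≤ C := (abs_nonneg _).trans (hb 0 0)
  refine h.trans ?_
  have h1 : (volume : Measure (I × I)).real (S ×ˢ T) ≤ 1 := measureReal_le_one
  nlinarith

theorem le_cutNorm {W : I → I → ℝ} {C : ℝ} (hb : ∀ x y, |W x y| ≤ C) {S T : Set I}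
    (hS : MeasurableSet S) (hT : MeasurableSet T) :
    |∫ p in S ×ˢ T, W p.1 p.2| ≤ cutNorm W :=
  le_csSup (bddAbove_cutNorm hb) ⟨S, T, hS, hT, rfl⟩

theorem cutNorm_le {W : I → I → ℝ} {c : ℝ}
    (h : ∀ S T : Set I, MeasurableSet S → MeasurableSet T → |∫ p in S ×ˢ T, W p.1 p.2| ≤ c) :
    cutNorm W ≤ c := by
  refine csSup_le ⟨_, ∅, ∅, MeasurableSet.empty, MeasurableSet.empty, rfl⟩ ?_
  rintro r ⟨S, T, hS, hT, rfl⟩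
  exact h S T hS hT

theorem cutNorm_nonneg (W : I → I → ℝ) : 0 ≤ cutNorm W := by
  refine Real.sSup_nonneg ?_
  rintro r ⟨S, T, -, -, rfl⟩
  exact abs_nonneg _

theorem cutNorm_congr {W W' : I → I → ℝ} (h : ∀ᵐ p : I × I, W p.1 p.2 = W' p.1 p.2) :
    cutNorm W = cutNorm W' := by
  have : ∀ S T : Set I, ∫ p in S ×ˢ T, W p.1 p.2 = ∫ p in S ×ˢ T, W' p.1 p.2 :=
    fun S T => integral_congr_ae (ae_restrict_of_ae h)
  simp only [cutNorm, this]

theorem cutNorm_zero : cutNorm (fun _ _ => 0) = 0 :=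
  le_antisymm (cutNorm_le fun S T _ _ => by simp) (cutNorm_nonneg _)

theorem cutNorm_sub_comm (A B : I → I → ℝ) :
    cutNorm (fun x y => A x y - B x y) = cutNorm (fun x y => B x y - A x y) := by
  have : ∀ S T : Set I, |∫ p in S ×ˢ T, (A p.1 p.2 - B p.1 p.2)|
      = |∫ p in S ×ˢ T, (B p.1 p.2 - A p.1 p.2)| := by
    intro S T
    rw [← abs_neg, ← integral_neg]
    simp
  simp only [cutNorm, this]

theorem integrable_of_bdd {W : I → I → ℝ} {C : ℝ}
    (hm : Measurable fun p : I × I => W p.1 p.2) (hb : ∀ x y, |W x y| ≤ C) :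
    Integrable (fun p : I × I => W p.1 p.2) :=
  Integrable.of_bound hm.aestronglyMeasurable C
    (ae_of_all _ fun p => by simpa [Real.norm_eq_abs] using hb p.1 p.2)

theorem cutNorm_add_le {A B : I → I → ℝ} {C : ℝ}
    (hA : Measurable fun p : I × I => A p.1 p.2) (hB : Measurable fun p : I × I => B p.1 p.2)
    (hA' : ∀ x y, |A x y| ≤ C) (hB' : ∀ x y, |B x y| ≤ C) :
    cutNorm (fun x y => A x y + B x y) ≤ cutNorm A + cutNorm B := by
  refine cutNorm_le fun S T hS hT => ?_
  rw [integral_add (integrable_of_bdd hA hA').integrableOn (integrable_of_bdd hB hB').integrableOn]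
  exact (abs_add_le _ _).trans (add_le_add (le_cutNorm hA' hS hT) (le_cutNorm hB' hS hT))

/-- A measurable choice of a point of the fibre of a measure preserving map. -/
theorem exists_fibre_sampler {γ : I → I} (hγ : MeasurePreserving γ) :
    ∃ h : I × I → I, MeasurePreserving h ∧ ∀ᵐ p : I × I, γ (h p) = p.1 := by
  obtain ⟨f, hf, hfκ⟩ := Kernel.exists_measurable_map_eq_unitInterval
    (condDistrib (id : I → I) γ (volume : Measure I))
  have hF : Measurable fun p : I × I => (p.1, Function.uncurry f p) := by fun_prop
  have hG : Measurable fun x : I => (γ x, x) := hγ.measurable.prodMk measurable_id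
  have key : Measure.map (fun p : I × I => (p.1, Function.uncurry f p)) volume
      = Measure.map (fun x : I => (γ x, x)) volume := by
    have h1 := compProd_map_condDistrib (mβ := inferInstance) (X := γ)
      (Y := (id : I → I)) (μ := (volume : Measure I)) aemeasurable_id
    rw [hγ.map_eq] at h1
    simp only [id] at h1
    rw [← h1]
    ext s hs
    rw [Measure.map_apply hF hs, Measure.compProd_apply hs, Measure.volume_eq_prod,
      Measure.prod_apply (hF hs)]
    refine lintegral_congr fun a => ?_
    rw [← hfκ a, Measure.map_apply (by fun_prop) (measurable_prodMk_left hs)]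
    rfl
  refine ⟨Function.uncurry f, ⟨hf, ?_⟩, ?_⟩
  · have := congrArg (Measure.map Prod.snd) key
    rw [Measure.map_map measurable_snd hF, Measure.map_map measurable_snd hG] at this
    exact this.trans Measure.map_id
  · have hs : MeasurableSet {q : I × I | γ q.2 = q.1} :=
      measurableSet_eq_fun (hγ.measurable.comp measurable_snd) measurable_fst
    have h2 : ∀ᵐ q ∂(Measure.map (fun x : I => (γ x, x)) volume), γ q.2 = q.1 :=
      (ae_map_iff hG.aemeasurable hs).2 (ae_of_all _ fun _ => rfl)
    rw [← key] at h2
    exact ae_of_ae_map hF.aemeasurable h2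

/-- Two measure preserving maps of `[0,1]` have a common refinement. -/
theorem exists_common_refinement {φ α : I → I} (hφ : MeasurePreserving φ)
    (hα : MeasurePreserving α) :
    ∃ γ γ' : I → I, MeasurePreserving γ ∧ MeasurePreserving γ' ∧
      ∀ᵐ t : I, φ (γ t) = α (γ' t) := by
  obtain ⟨h, hh, hh'⟩ := exists_fibre_sampler hφ
  obtain ⟨k, hk, hk'⟩ := exists_fibre_sampler hα
  obtain ⟨e, he, hev⟩ := Measure.exists_measurable_map_eq (volume : Measure (I × (I × I)))
  have hE : MeasurePreserving e := ⟨he, hev⟩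
  have m1 : MeasurePreserving (fun q : I × (I × I) => (q.1, q.2.1)) :=
    (MeasurePreserving.id (volume : Measure I)).prod
      (measurePreserving_fst (μ := (volume : Measure I)) (ν := (volume : Measure I)))
  have m2 : MeasurePreserving (fun q : I × (I × I) => (q.1, q.2.2)) :=
    (MeasurePreserving.id (volume : Measure I)).prod
      (measurePreserving_snd (μ := (volume : Measure I)) (ν := (volume : Measure I)))
  refine ⟨fun t => h ((e t).1, (e t).2.1), fun t => k ((e t).1, (e t).2.2),
    hh.comp (m1.comp hE), hk.comp (m2.comp hE), ?_⟩
  have a1 := (m1.comp hE).quasiMeasurePreserving.ae hh'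
  have a2 := (m2.comp hE).quasiMeasurePreserving.ae hk'
  filter_upwards [a1, a2] with t h1 h2
  simp only [Function.comp_apply] at h1 h2
  rw [h1, h2]

theorem measurePreserving_shuffle :
    MeasurePreserving (fun q : (I × I) × (I × I) => ((q.1.1, q.2.1), (q.1.2, q.2.2))) := by
  have i := MeasurePreserving.id (volume : Measure I)
  have s1 := volume_preserving_prodAssoc (α₁ := I) (β₁ := I) (γ₁ := I × I)
  have s2 := i.prod ((volume_preserving_prodAssoc (α₁ := I) (β₁ := I) (γ₁ := I)).symm)
  have s3 := i.prod ((Measure.measurePreserving_swap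
    (μ := (volume : Measure I)) (ν := (volume : Measure I))).prod i)
  have s4 := i.prod (volume_preserving_prodAssoc (α₁ := I) (β₁ := I) (γ₁ := I))
  have s5 := (volume_preserving_prodAssoc (α₁ := I) (β₁ := I) (γ₁ := I × I)).symm
  exact s5.comp (s4.comp (s3.comp (s2.comp s1)))

/-- The cut norm does not increase under pullback by a measure preserving map. -/
theorem cutNorm_pullback_le {F : I → I → ℝ} {C : ℝ}
    (hm : Measurable fun p : I × I => F p.1 p.2) (hb : ∀ x y, |F x y| ≤ C)
    {γ : I → I} (hγ : MeasurePreserving γ) :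
    cutNorm (fun x y => F (γ x) (γ y)) ≤ cutNorm F := by
  refine cutNorm_le fun S T hS hT => ?_
  obtain ⟨h, hh, hh'⟩ := exists_fibre_sampler hγ
  have hhm := hh.measurable
  have hγm := hγ.measurable
  have hΦ : MeasurePreserving
      (fun q : (I × I) × (I × I) => (h (q.1.1, q.2.1), h (q.1.2, q.2.2))) :=
    (hh.prod hh).comp measurePreserving_shuffle
  have hFγ : Measurable fun p : I × I => F (γ p.1) (γ p.2) :=
    hm.comp (f := fun p : I × I => (γ p.1, γ p.2)) (by fun_prop)
  have hST := hS.prod hT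
  let G : (I × I) × (I × I) → ℝ := fun q =>
    ((S ×ˢ T).indicator (fun _ => (1 : ℝ)) (h (q.1.1, q.2.1), h (q.1.2, q.2.2))) * F q.1.1 q.1.2
  have hGm : Measurable G :=
    ((measurable_const.indicator hST).comp hΦ.measurable).mul
      (hm.comp (f := fun q : (I × I) × (I × I) => (q.1.1, q.1.2)) (by fun_prop))
  have hGi : Integrable G ((volume : Measure (I × I)).prod (volume : Measure (I × I))) := by
    refine Integrable.of_bound hGm.aestronglyMeasurable C (ae_of_all _ fun q => ?_)
    have hC : 0 ≤ C := (abs_nonneg _).trans (hb 0 0)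
    simp only [G, Real.norm_eq_abs, abs_mul]
    by_cases hq : (h (q.1.1, q.2.1), h (q.1.2, q.2.2)) ∈ S ×ˢ T
    · simpa [Set.indicator_of_mem hq] using hb _ _
    · simpa [Set.indicator_of_notMem hq] using hC
  have e1 : ∫ p in S ×ˢ T, F (γ p.1) (γ p.2) = ∫ q, G q := by
    rw [← integral_indicator hST, ← hΦ.map_eq, integral_map hΦ.measurable.aemeasurable
      (hFγ.indicator hST).aestronglyMeasurable]
    refine integral_congr_ae ?_
    have b1 := ((measurePreserving_fst (μ := (volume : Measure (I × I)))
      (ν := (volume : Measure (I × I)))).comp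
        measurePreserving_shuffle).quasiMeasurePreserving.ae hh'
    have b2 := ((measurePreserving_snd (μ := (volume : Measure (I × I)))
      (ν := (volume : Measure (I × I)))).comp
        measurePreserving_shuffle).quasiMeasurePreserving.ae hh'
    filter_upwards [b1, b2] with q h1 h2
    simp only [Function.comp_apply] at h1 h2
    simp only [G]
    by_cases hq : (h (q.1.1, q.2.1), h (q.1.2, q.2.2)) ∈ S ×ˢ T
    · rw [Set.indicator_of_mem hq, Set.indicator_of_mem hq, h1, h2, one_mul]
    · rw [Set.indicator_of_notMem hq, Set.indicator_of_notMem hq, zero_mul]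
  rw [e1, Measure.volume_eq_prod, integral_prod_symm G hGi, ← Real.norm_eq_abs]
  have bound : ∀ r : I × I, ‖∫ p : I × I, G (p, r)‖ ≤ cutNorm F := by
    intro r
    have mS : MeasurableSet {a : I | h (a, r.1) ∈ S} :=
      (hhm.comp (measurable_id.prodMk measurable_const)) hS
    have mT : MeasurableSet {b : I | h (b, r.2) ∈ T} :=
      (hhm.comp (measurable_id.prodMk measurable_const)) hT
    refine le_trans (le_of_eq ?_) (le_cutNorm hb mS mT)
    rw [Real.norm_eq_abs, ← integral_indicator (mS.prod mT)]
    congr 1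
    refine integral_congr_ae (ae_of_all _ fun p => ?_)
    by_cases hp : (h (p.1, r.1), h (p.2, r.2)) ∈ S ×ˢ T
    · have hp' : p ∈ {a : I | h (a, r.1) ∈ S} ×ˢ {b : I | h (b, r.2) ∈ T} := hp
      simp [G, Set.indicator_of_mem hp, Set.indicator_of_mem hp']
    · have hp' : p ∉ {a : I | h (a, r.1) ∈ S} ×ˢ {b : I | h (b, r.2) ∈ T} := hp
      simp [G, Set.indicator_of_notMem hp, Set.indicator_of_notMem hp']
  have := norm_integral_le_of_norm_le_const (μ := (volume : Measure (I × I)))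
    (f := fun r : I × I => ∫ p : I × I, G (p, r)) (ae_of_all _ bound)
  simpa using this

theorem SymmKernel.abs_le (W : SymmKernel) (x y : I) : |W.1 x y| ≤ 1 :=
  _root_.abs_le.2 (W.2.mem_Icc x y)

theorem SymmKernel.measurable_pullback (W : SymmKernel) {φ : I → I} (hφ : Measurable φ) :
    Measurable fun p : I × I => W.1 (φ p.1) (φ p.2) :=
  W.2.measurable.comp (f := fun p : I × I => (φ p.1, φ p.2)) (by fun_prop)

theorem abs_sub_le_two (W₁ W₂ : SymmKernel) (x y x' y' : I) :
    |W₁.1 x y - W₂.1 x' y'| ≤ 2 := by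
  have h1 := W₁.2.mem_Icc x y
  have h2 := W₂.2.mem_Icc x' y'
  rw [_root_.abs_le]
  constructor <;> linarith [h1.1, h1.2, h2.1, h2.2]

theorem cutDist_le (W₁ W₂ : SymmKernel) {φ ψ : I → I} (hφ : MeasurePreserving φ)
    (hψ : MeasurePreserving ψ) :
    cutDist W₁ W₂ ≤ cutNorm fun x y => W₁.1 (φ x) (φ y) - W₂.1 (ψ x) (ψ y) := by
  refine csInf_le ⟨0, ?_⟩ ⟨φ, ψ, hφ, hψ, rfl⟩
  rintro r ⟨_, _, _, _, rfl⟩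
  exact cutNorm_nonneg _

theorem cutDist_nonneg (W₁ W₂ : SymmKernel) : 0 ≤ cutDist W₁ W₂ := by
  refine Real.sInf_nonneg ?_
  rintro r ⟨_, _, _, _, rfl⟩
  exact cutNorm_nonneg _

theorem cutDist_self (W : SymmKernel) : cutDist W W = 0 := by
  refine le_antisymm ?_ (cutDist_nonneg _ _)
  refine (cutDist_le W W (MeasurePreserving.id _) (MeasurePreserving.id _)).trans ?_
  simp [cutNorm_zero]

theorem cutDist_comm (W₁ W₂ : SymmKernel) : cutDist W₁ W₂ = cutDist W₂ W₁ := by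
  unfold cutDist
  congr 1
  ext r
  constructor
  · rintro ⟨φ, ψ, hφ, hψ, rfl⟩
    exact ⟨ψ, φ, hψ, hφ, cutNorm_sub_comm _ _⟩
  · rintro ⟨φ, ψ, hφ, hψ, rfl⟩
    exact ⟨ψ, φ, hψ, hφ, cutNorm_sub_comm _ _⟩

theorem exists_lt_of_cutDist_lt {W₁ W₂ : SymmKernel} {c : ℝ} (h : cutDist W₁ W₂ < c) :
    ∃ φ ψ : I → I, MeasurePreserving φ ∧ MeasurePreserving ψ ∧
      cutNorm (fun x y => W₁.1 (φ x) (φ y) - W₂.1 (ψ x) (ψ y)) < c := by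
  obtain ⟨r, ⟨φ, ψ, hφ, hψ, rfl⟩, hr⟩ := exists_lt_of_csInf_lt
    (⟨_, id, id, MeasurePreserving.id _, MeasurePreserving.id _, rfl⟩ :
      {r : ℝ | ∃ φ ψ : I → I, MeasurePreserving φ ∧ MeasurePreserving ψ ∧
        r = cutNorm fun x y => W₁.1 (φ x) (φ y) - W₂.1 (ψ x) (ψ y)}.Nonempty) h
  exact ⟨φ, ψ, hφ, hψ, hr⟩

theorem ae_pair {P : I → Prop} (h : ∀ᵐ t : I, P t) : ∀ᵐ p : I × I, P p.1 ∧ P p.2 := by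
  have h1 := (measurePreserving_fst (μ := (volume : Measure I))
    (ν := (volume : Measure I))).quasiMeasurePreserving.ae h
  have h2 := (measurePreserving_snd (μ := (volume : Measure I))
    (ν := (volume : Measure I))).quasiMeasurePreserving.ae h
  exact h1.and h2

theorem cutDist_triangle (W₁ W₂ W₃ : SymmKernel) :
    cutDist W₁ W₃ ≤ cutDist W₁ W₂ + cutDist W₂ W₃ := by
  refine le_of_forall_pos_le_add fun ε hε => ?_
  obtain ⟨φ, ψ, hφ, hψ, h12⟩ :=
    exists_lt_of_cutDist_lt (lt_add_of_pos_right (cutDist W₁ W₂) (half_pos hε))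
  obtain ⟨α, β, hα, hβ, h23⟩ :=
    exists_lt_of_cutDist_lt (lt_add_of_pos_right (cutDist W₂ W₃) (half_pos hε))
  obtain ⟨γ, γ', hγ, hγ', hglue⟩ := exists_common_refinement hψ hα
  have k1 := cutNorm_pullback_le (F := fun x y => W₁.1 (φ x) (φ y) - W₂.1 (ψ x) (ψ y))
    ((W₁.measurable_pullback hφ.measurable).sub (W₂.measurable_pullback hψ.measurable))
    (fun x y => abs_sub_le_two W₁ W₂ _ _ _ _) hγ
  have k2 := cutNorm_pullback_le (F := fun x y => W₂.1 (α x) (α y) - W₃.1 (β x) (β y))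
    ((W₂.measurable_pullback hα.measurable).sub (W₃.measurable_pullback hβ.measurable))
    (fun x y => abs_sub_le_two W₂ W₃ _ _ _ _) hγ'
  have k3 := cutNorm_add_le (C := 2)
    (A := fun x y => W₁.1 (φ (γ x)) (φ (γ y)) - W₂.1 (ψ (γ x)) (ψ (γ y)))
    (B := fun x y => W₂.1 (α (γ' x)) (α (γ' y)) - W₃.1 (β (γ' x)) (β (γ' y)))
    ((W₁.measurable_pullback (hφ.comp hγ).measurable).sub
      (W₂.measurable_pullback (hψ.comp hγ).measurable))
    ((W₂.measurable_pullback (hα.comp hγ').measurable).sub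
      (W₃.measurable_pullback (hβ.comp hγ').measurable))
    (fun x y => abs_sub_le_two W₁ W₂ _ _ _ _) (fun x y => abs_sub_le_two W₂ W₃ _ _ _ _)
  have k4 : cutNorm (fun x y => W₁.1 (φ (γ x)) (φ (γ y)) - W₃.1 (β (γ' x)) (β (γ' y)))
      = cutNorm (fun x y => (W₁.1 (φ (γ x)) (φ (γ y)) - W₂.1 (ψ (γ x)) (ψ (γ y)))
        + (W₂.1 (α (γ' x)) (α (γ' y)) - W₃.1 (β (γ' x)) (β (γ' y)))) := by
    refine cutNorm_congr ?_
    filter_upwards [ae_pair hglue] with p hp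
    rw [hp.1, hp.2]
    ring
  have k5 := cutDist_le W₁ W₃ (hφ.comp hγ) (hβ.comp hγ')
  simp only [Function.comp_apply] at k5
  linarith

theorem cutDist_eq_zero_of_weakIso {W₁ W₂ : SymmKernel} (h : WeakIso W₁ W₂) :
    cutDist W₁ W₂ = 0 := by
  obtain ⟨W, -, φ₁, φ₂, h1, h2, e1, e2⟩ := h
  obtain ⟨γ, γ', hγ, hγ', hglue⟩ := exists_common_refinement h1 h2
  refine le_antisymm ((cutDist_le W₁ W₂ hγ hγ').trans (le_of_eq ?_)) (cutDist_nonneg _ _)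
  rw [← cutNorm_zero]
  refine cutNorm_congr ?_
  filter_upwards [ae_pair hglue, (hγ.prod hγ).quasiMeasurePreserving.ae e1,
    (hγ'.prod hγ').quasiMeasurePreserving.ae e2] with p hp a1 a2
  simp only [Prod.map_fst, Prod.map_snd] at a1 a2
  rw [a1, a2, hp.1, hp.2, sub_self]

theorem cutDist_congr_left {W W' V : SymmKernel} (h : WeakIso W W') :
    cutDist W V = cutDist W' V := by
  have h0 := cutDist_eq_zero_of_weakIso h
  have t1 := cutDist_triangle W W' V
  have t2 := cutDist_triangle W' W V
  rw [cutDist_comm W' W] at t2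
  linarith

theorem cutDist_congr_right {W V V' : SymmKernel} (h : WeakIso V V') :
    cutDist W V = cutDist W V' := by
  rw [cutDist_comm W V, cutDist_comm W V', cutDist_congr_left h]

/-- The cut metric `δ_□` on graphons: `δ_□([W₁],[W₂]) = inf_{φ,ψ} ‖W₁^φ - W₂^ψ‖_□`. -/
noncomputable def Graphon.cutMetric (a b : Graphon) : ℝ :=
  Quot.lift₂ cutDist (fun _ _ _ h => cutDist_congr_right h)
    (fun _ _ _ h => cutDist_congr_left h) a b

/-- Graphons carry the topology of the cut metric. -/
noncomputable instance : PseudoMetricSpace Graphon where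
  dist := Graphon.cutMetric
  dist_self a := Quot.inductionOn a cutDist_self
  dist_comm a b := Quot.induction_on₂ a b cutDist_comm
  dist_triangle a b c := Quot.induction_on₃ a b c cutDist_triangle

/-- Graphons carry the Borel σ-algebra of the cut metric. -/
noncomputable instance : MeasurableSpace Graphon := borel Graphon

instance : BorelSpace Graphon := ⟨rfl⟩

theorem isKernel_zero : IsKernel fun _ _ => 0 where
  measurable := measurable_const
  bounded := ⟨0, by simp⟩
  symm := ae_of_all _ fun _ => rfl
  mem_Icc := by simp

open Classical in
/-- `[W]` for a function `W` on the square that is a kernel; the graphon `[0]` otherwise. -/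
noncomputable def graphonOf (W : I → I → ℝ) : Graphon :=
  if h : IsKernel W then SymmKernel.toGraphon ⟨W, h⟩ else SymmKernel.toGraphon ⟨_, isKernel_zero⟩

/-! ## Exchangeable arrays and their finite truncations -/

instance : Nonempty (Set.Icc (-1 : ℝ) 1) := ⟨⟨0, by simp⟩⟩

/-- The index set `ℕ^(2)` of pairs `i < j`, which stand for the unordered pairs `{i, j}`. -/
abbrev Pair : Type := {p : ℕ × ℕ // p.1 < p.2}

/-- The pair `{i, j}` for `i ≠ j`. -/
def mkPair (i j : ℕ) (h : i ≠ j) : Pair :=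
  ⟨(min i j, max i j), min_lt_max.2 h⟩

/-- The action of a permutation of `ℕ` on unordered pairs. -/
def permPair (π : Equiv.Perm ℕ) (p : Pair) : Pair :=
  mkPair (π p.1.1) (π p.1.2) (π.injective.ne p.2.ne)

/-- `ζ` is an exchangeable symmetric array of random elements of `E`: its law is invariant under
finite permutations of `ℕ`. -/
structure IsExchangeableArray {Ω E : Type*} [MeasurableSpace Ω] [MeasurableSpace E]
    (P : Measure Ω) (ζ : Pair → Ω → E) : Prop where
  measurable : ∀ p, Measurable (ζ p)
  law_eq : ∀ π : Equiv.Perm ℕ, {i | π i ≠ i}.Finite →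
    P.map (fun ω p => ζ (permPair π p) ω) = P.map (fun ω p => ζ p ω)

/-- Labels of the variables `U`, `U_i`, `U_{i,j}` of the Aldous-Hoover representation. -/
inductive Seed : Type
  | root : Seed
  | vertex : ℕ → Seed
  | edge : Pair → Seed

/-- The variables `U`, `U_i`, `U_{i,j}` are independent and uniform on `[0,1]`. -/
structure IsIIDUniform {Ω : Type*} [MeasurableSpace Ω] (P : Measure Ω) (U : Seed → Ω → I) :
    Prop where
  measurable : ∀ s, Measurable (U s)
  uniform : ∀ s, P.map (U s) = volume
  indep : iIndepFun U P

/-- The array `ζ` is directed by the measurable function `f`, by means of the i.i.d. uniform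
variables `U`: almost surely `ζ_{i,j} = f(U, U_i, U_j, U_{i,j}) = f(U, U_j, U_i, U_{i,j})`. -/
structure IsDirectedBy {Ω E : Type*} [MeasurableSpace Ω] [MeasurableSpace E] (P : Measure Ω)
    (ζ : Pair → Ω → E) (f : I → I → I → I → E) (U : Seed → Ω → I) : Prop where
  measurable : Measurable fun q : I × I × I × I => f q.1 q.2.1 q.2.2.1 q.2.2.2
  iid : IsIIDUniform P U
  eq : ∀ p : Pair, ∀ᵐ ω ∂P, ζ p ω =
    f (U .root ω) (U (.vertex p.1.1) ω) (U (.vertex p.1.2) ω) (U (.edge p) ω)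
  eq_swap : ∀ p : Pair, ∀ᵐ ω ∂P, ζ p ω =
    f (U .root ω) (U (.vertex p.1.2) ω) (U (.vertex p.1.1) ω) (U (.edge p) ω)

/-- `g_u(x,y) = E f(u,x,y,V)` with `V` uniform on `[0,1]`. -/
noncomputable def meanKernel (f : I → I → I → I → Set.Icc (-1 : ℝ) 1) (u x y : I) : ℝ :=
  ∫ v : I, (f u x y v : ℝ)

/-- The index in `{0, …, n-1}` of the interval of length `1/n` that contains `x`; intervals are
closed on the left, and the last one contains `1`. -/
noncomputable def blockIndex (n : ℕ) (x : I) : ℕ := min ⌊(n : ℝ) * (x : ℝ)⌋₊ (n - 1)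

/-- The `(i, j)` entry of the symmetric matrix with off-diagonal entries `a`; the diagonal, which
the array does not determine, is set to `0`. -/
noncomputable def matrixEntry (a : Pair → Set.Icc (-1 : ℝ) 1) (i j : ℕ) : ℝ :=
  if h : i ≠ j then (a (mkPair i j h) : ℝ) else 0

/-- The `n × n` truncation of `a` as a step function, constant on products of the `n` intervals. -/
noncomputable def stepFun (n : ℕ) (a : Pair → Set.Icc (-1 : ℝ) 1) (x y : I) : ℝ :=
  matrixEntry a (blockIndex n x) (blockIndex n y)

theorem isKernel_stepFun (n : ℕ) (a : Pair → Set.Icc (-1 : ℝ) 1) : IsKernel (stepFun n a) := by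
  have hmem : ∀ i j, matrixEntry a i j ∈ Set.Icc (-1 : ℝ) 1 := by
    intro i j
    unfold matrixEntry
    split_ifs
    · exact (a _).2
    · simp
  have hsymm : ∀ i j, matrixEntry a i j = matrixEntry a j i := by
    intro i j
    unfold matrixEntry
    by_cases h : i = j
    · subst h; rfl
    · rw [dif_pos h, dif_pos (Ne.symm h)]
      have : mkPair i j h = mkPair j i (Ne.symm h) := by
        apply Subtype.ext
        simp [mkPair, min_comm, max_comm]
      rw [this]
  have hblock : Measurable (blockIndex n) := by
    unfold blockIndex
    fun_prop
  refine ⟨⟨?_, ⟨1, fun x y => abs_le.2 (hmem _ _)⟩, ae_of_all _ fun p => hsymm _ _⟩,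
    fun x y => hmem _ _⟩
  have : Measurable fun q : ℕ × ℕ => matrixEntry a q.1 q.2 := measurable_of_countable _
  exact this.comp (f := fun p : I × I => (blockIndex n p.1, blockIndex n p.2)) (by fun_prop)

/-- The graphon of the `n × n` truncation of the array `a`. -/
noncomputable def truncGraphon (n : ℕ) (a : Pair → Set.Icc (-1 : ℝ) 1) : Graphon :=
  SymmKernel.toGraphon ⟨stepFun n a, isKernel_stepFun n a⟩

end RandomGraphon

open RandomGraphon

/-! Fix `u` with `W = g_u` a kernel, and write `X i`, `V p` for the vertex and edge variables. Given
the vertex variables, the deviations of the entries `f(u, X i, X j, V p)` from `W (X i) (X j)` are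
independent, centred and bounded, so by Hoeffding the sum over one rectangle exceeds `ε n²` with
probability at most `2 exp(-ε² n² / 8)`. This beats the union bound over the `4 ^ n` rectangles `S ×
T`, so by Borel-Cantelli the noise vanishes in the cut norm (`ae_eventually_noise_lt`).

It remains to compare the sampled matrix `W (X i) (X j)` with `W`. Approximate `W` in `L¹` by a step
function `c` on an `m × m` grid. On the sample, the average of `|W - c|` is eventually at most four
times its small mean, up to `ε` (`ae_eventually_sum_pairs_le`). The sampled `c` depends only on the
block labels of the `X i`, whose empirical law tends to the uniform one; a maximal coupling of the
two label laws supplies the measure preserving maps that align the sampled `c` with `c`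
(`exists_coupling`). The deterministic bound `cutDist_stepFun_le` adds these errors, and
`ae_tendsto_cutDist` lets them tend to zero.

The rest follows from this convergence. The root is independent of the other seeds, so Fubini gives
almost sure convergence of the truncations of `ζ` to `[g_U]`, and disintegration gives the
conditional statement. Measurability of `[g_u]` in `u` holds because `F [g_u]`, for bounded
continuous `F`, is a limit of expectations of `F` at sampled truncations. Truncation is a continuous
function of the array, so the law of the limit `[g_U]` is determined by the law of `ζ`. -/

namespace RandomGraphon

/-! ## Block functions -/

theorem measurable_blockIndex (n : ℕ) : Measurable (blockIndex n) := by
  unfold blockIndex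
  fun_prop

theorem blockIndex_lt {n : ℕ} (hn : 0 < n) (x : I) : blockIndex n x < n := by
  unfold blockIndex
  omega

/-- Superlevel sets of the index are half-lines and each block is a difference of two of them. In
this form the last block, which is closed at `1`, needs no separate treatment: the set for `i = n`
is empty because of the cap at `n - 1`. -/
theorem volume_blockIndex_ge {n : ℕ} (hn : 0 < n) {i : ℕ} (hi : i ≤ n) :
    volume.real {x : I | i ≤ blockIndex n x} = 1 - (i : ℝ) / n := by
  have hn' : (0 : ℝ) < n := by exact_mod_cast hn
  rcases hi.lt_or_eq with hi | rfl
  · have hmem : (i : ℝ) / n ∈ I := by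
      refine ⟨by positivity, ?_⟩
      rw [div_le_one hn']
      exact_mod_cast hi.le
    have : {x : I | i ≤ blockIndex n x} = Set.Ici ⟨(i : ℝ) / n, hmem⟩ := by
      ext x
      have hx : 0 ≤ (n : ℝ) * (x : ℝ) := mul_nonneg hn'.le x.2.1
      simp only [blockIndex, Set.mem_ofPred_eq, le_min_iff, Set.mem_Ici, Nat.le_floor_iff hx]
      rw [← Subtype.coe_le_coe, div_le_iff₀ hn', mul_comm]
      constructor
      · exact fun h => h.1
      · exact fun h => ⟨h, by omega⟩
    rw [this, Measure.real, unitInterval.volume_Ici, ENNReal.toReal_ofReal]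
    linarith [hmem.2]
  · have : {x : I | i ≤ blockIndex i x} = ∅ := by
      ext x
      simpa using blockIndex_lt hn x
    rw [this, div_self hn'.ne']
    simp

theorem volume_blockIndex_eq {n : ℕ} {i : ℕ} (hi : i < n) :
    volume.real (blockIndex n ⁻¹' {i}) = 1 / n := by
  have hn : 0 < n := by omega
  have : blockIndex n ⁻¹' {i} = {x : I | i ≤ blockIndex n x} \ {x | i + 1 ≤ blockIndex n x} := by
    ext x
    simp only [Set.mem_preimage, Set.mem_singleton_iff, Set.mem_sdiff, Set.mem_ofPred_eq]
    omega
  have hsub : {x : I | i + 1 ≤ blockIndex n x} ⊆ {x : I | i ≤ blockIndex n x} :=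
    fun x hx => le_trans (Nat.le_succ i) hx
  rw [this, measureReal_sdiff hsub (measurable_blockIndex n measurableSet_Ici), volume_blockIndex_ge hn hi.le,
    volume_blockIndex_ge hn hi]
  push_cast
  ring

/-- The step function on the unit square with the entries of an `n × n` matrix. -/
noncomputable def blockFun (n : ℕ) (A : ℕ → ℕ → ℝ) (x y : I) : ℝ :=
  A (blockIndex n x) (blockIndex n y)

theorem measurable_comp_nat {α : Type*} [MeasurableSpace α] {τ ρ : α → ℕ} (hτ : Measurable τ)
    (hρ : Measurable ρ) (A : ℕ → ℕ → ℝ) : Measurable fun p : α × α => A (τ p.1) (ρ p.2) := by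
  have : Measurable fun q : ℕ × ℕ => A q.1 q.2 := measurable_of_countable _
  exact this.comp (f := fun p : α × α => (τ p.1, ρ p.2)) (by fun_prop)

theorem measurable_blockFun (n : ℕ) (A : ℕ → ℕ → ℝ) :
    Measurable fun p : I × I => blockFun n A p.1 p.2 :=
  measurable_comp_nat (measurable_blockIndex n) (measurable_blockIndex n) A

theorem blockFun_eq_sum {n : ℕ} (hn : 0 < n) (A : ℕ → ℕ → ℝ) (x y : I) :
    blockFun n A x y = ∑ i ∈ Finset.range n, ∑ j ∈ Finset.range n,
      ((blockIndex n ⁻¹' {i}) ×ˢ (blockIndex n ⁻¹' {j})).indicator (fun _ => A i j) (x, y) := by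
  rw [Finset.sum_eq_single (blockIndex n x), Finset.sum_eq_single (blockIndex n y)]
  · simp [blockFun, Set.indicator]
  · intro j _ hj
    exact Set.indicator_of_notMem (fun h => hj h.2.symm) _
  · exact fun h => absurd (Finset.mem_range.2 (blockIndex_lt hn y)) h
  · intro i _ hi
    exact Finset.sum_eq_zero fun j _ => Set.indicator_of_notMem (fun h => hi h.1.symm) _
  · exact fun h => absurd (Finset.mem_range.2 (blockIndex_lt hn x)) h

theorem setIntegral_blockFun {n : ℕ} (hn : 0 < n) (A : ℕ → ℕ → ℝ) (S T : Set I) :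
    ∫ p in S ×ˢ T, blockFun n A p.1 p.2 = ∑ i ∈ Finset.range n, ∑ j ∈ Finset.range n,
      volume.real (blockIndex n ⁻¹' {i} ∩ S) * volume.real (blockIndex n ⁻¹' {j} ∩ T)
        * A i j := by
  have hm : ∀ i j, MeasurableSet ((blockIndex n ⁻¹' {i}) ×ˢ (blockIndex n ⁻¹' {j})) := fun i j =>
    (measurable_blockIndex n (measurableSet_singleton i)).prod
      (measurable_blockIndex n (measurableSet_singleton j))
  have hi : ∀ i j, Integrable (((blockIndex n ⁻¹' {i}) ×ˢ (blockIndex n ⁻¹' {j})).indicator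
      fun _ => A i j) (volume.restrict (S ×ˢ T)) := fun i j =>
    (integrable_const _).indicator (hm i j)
  simp_rw [blockFun_eq_sum hn A]
  rw [integral_finsetSum _ fun i _ => integrable_finsetSum _ fun j _ => hi i j]
  refine Finset.sum_congr rfl fun i _ => ?_
  rw [integral_finsetSum _ fun j _ => hi i j]
  refine Finset.sum_congr rfl fun j _ => ?_
  rw [integral_indicator (hm i j), setIntegral_const, measureReal_restrict_apply (hm i j),
    Set.prod_inter_prod, Measure.volume_eq_prod, measureReal_prod_prod, smul_eq_mul]

theorem integral_blockFun {n : ℕ} (hn : 0 < n) (A : ℕ → ℕ → ℝ) :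
    ∫ p : I × I, blockFun n A p.1 p.2 =
      (∑ i ∈ Finset.range n, ∑ j ∈ Finset.range n, A i j) / (n : ℝ) ^ 2 := by
  have := setIntegral_blockFun hn A Set.univ Set.univ
  rw [Set.univ_prod_univ, Measure.restrict_univ] at this
  rw [this, Finset.sum_div]
  refine Finset.sum_congr rfl fun i hi => ?_
  rw [Finset.sum_div]
  refine Finset.sum_congr rfl fun j hj => ?_
  rw [Set.inter_univ, Set.inter_univ, volume_blockIndex_eq (Finset.mem_range.1 hi),
    volume_blockIndex_eq (Finset.mem_range.1 hj)]
  have : (n : ℝ) ≠ 0 := by exact_mod_cast hn.ne'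
  field_simp

/-- A combination with weights in `[0, c]` is controlled by the subset sums. -/
theorem abs_sum_mul_le {ι : Type*} [DecidableEq ι] {s : Finset ι} {w r : ι → ℝ} {c M : ℝ}
    (hw : ∀ i ∈ s, w i ∈ Set.Icc 0 c) (hc : 0 ≤ c)
    (hM : ∀ S ⊆ s, |∑ i ∈ S, r i| ≤ M) : |∑ i ∈ s, w i * r i| ≤ c * M := by
  have key : ∀ r : ι → ℝ, (∀ S ⊆ s, |∑ i ∈ S, r i| ≤ M) → ∑ i ∈ s, w i * r i ≤ c * M := by
    intro r hM
    -- A linear form on the cube of weights is largest at a vertex: weight `c` where `r` is positive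
    -- and `0` elsewhere.
    calc ∑ i ∈ s, w i * r i ≤ ∑ i ∈ s, if 0 < r i then c * r i else 0 := by
          refine Finset.sum_le_sum fun i hi => ?_
          obtain ⟨h0, h1⟩ := hw i hi
          split_ifs with h
          · exact mul_le_mul_of_nonneg_right h1 h.le
          · exact mul_nonpos_of_nonneg_of_nonpos h0 (not_lt.1 h)
      _ = c * ∑ i ∈ s.filter (fun i => 0 < r i), r i := by
          rw [← Finset.sum_filter, Finset.mul_sum]
      _ ≤ c * M := mul_le_mul_of_nonneg_left
          ((le_abs_self _).trans (hM _ (Finset.filter_subset _ _))) hc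
  refine abs_le.2 ⟨?_, key r hM⟩
  have := key (fun i => -r i) fun S hS => by simpa using hM S hS
  simp only [mul_neg, Finset.sum_neg_distrib] at this
  linarith

/-- The integral over `S × T` is bilinear in the masses that `S` and `T` take from the blocks, each
in `[0, 1/n]`. Passing to extreme weights in one variable and then in the other leaves unions of
whole blocks, hence finitely many rectangles. -/
theorem cutNorm_blockFun_le {n : ℕ} (hn : 0 < n) {A : ℕ → ℕ → ℝ} {ε : ℝ}
    (h : ∀ S ⊆ Finset.range n, ∀ T ⊆ Finset.range n,
      |∑ i ∈ S, ∑ j ∈ T, A i j| ≤ ε * (n : ℝ) ^ 2) :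
    cutNorm (blockFun n A) ≤ ε := by
  refine cutNorm_le fun S T hS hT => ?_
  rw [setIntegral_blockFun hn]
  have hn' : (n : ℝ) ≠ 0 := by exact_mod_cast hn.ne'
  have hw : ∀ S : Set I, ∀ i ∈ Finset.range n,
      volume.real (blockIndex n ⁻¹' {i} ∩ S) ∈ Set.Icc (0 : ℝ) (1 / n) := fun S i hi =>
    ⟨measureReal_nonneg, (measureReal_mono Set.inter_subset_left).trans
      (volume_blockIndex_eq (Finset.mem_range.1 hi)).le⟩
  have e : ε = 1 / (n : ℝ) * (1 / (n : ℝ) * (ε * (n : ℝ) ^ 2)) := by field_simp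
  rw [e]
  simp_rw [mul_assoc, ← Finset.mul_sum]
  refine abs_sum_mul_le (hw S) (by positivity) fun S' hS' => ?_
  rw [Finset.sum_comm]
  simp_rw [← Finset.mul_sum]
  refine abs_sum_mul_le (hw T) (by positivity) fun T' hT' => ?_
  rw [Finset.sum_comm]
  exact h S' hS' T' hT'

theorem cutNorm_le_integral {F : I → I → ℝ} {C : ℝ}
    (hm : Measurable fun p : I × I => F p.1 p.2) (hb : ∀ x y, |F x y| ≤ C) :
    cutNorm F ≤ ∫ p : I × I, |F p.1 p.2| := by
  refine cutNorm_le fun S T _ _ => ?_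
  have hi := (integrable_of_bdd hm hb).abs
  exact abs_integral_le_integral_abs.trans
    (setIntegral_le_integral hi (ae_of_all _ fun p => abs_nonneg _))

/-! ## Coupling of two maps with finitely many values -/

open scoped ENNReal in
/-- The maximal coupling of two mixtures of probability measures. -/
theorem exists_mixture_coupling {α : Type*} [MeasurableSpace α] (s : Finset ℕ)
    (κ η : ℕ → Measure α) [∀ k, IsFiniteMeasure (κ k)] [∀ k, IsFiniteMeasure (η k)]
    (p q : ℕ → ℝ≥0∞) (hκ : ∀ k, p k = 0 ∨ κ k Set.univ = 1) (hη : ∀ k, q k = 0 ∨ η k Set.univ = 1)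
    (hp : ∑ k ∈ s, p k = 1) (hq : ∑ k ∈ s, q k = 1) :
    ∃ μ : Measure (α × α), μ.map Prod.fst = ∑ k ∈ s, p k • κ k ∧
      μ.map Prod.snd = ∑ k ∈ s, q k • η k ∧
      ∀ E : Set (α × α), (∀ k ∈ s, (κ k).prod (η k) E = 0) →
        μ E ≤ ∑ k ∈ s, (p k - q k) := by
  -- `r` is the overlap of the two weights and `ρ` the mass left over, which is the same on both
  -- sides because both weights have total mass one.
  set r : ℕ → ℝ≥0∞ := fun k => min (p k) (q k) with hr
  set ρ : ℝ≥0∞ := ∑ k ∈ s, (p k - r k) with hρ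
  have hr1 : ∑ k ∈ s, r k ≤ 1 := (Finset.sum_le_sum fun k _ => min_le_left _ _).trans hp.le
  have hrt : ∑ k ∈ s, r k ≠ ∞ := ne_top_of_le_ne_top ENNReal.one_ne_top hr1
  have hρ' : ρ = ∑ k ∈ s, (q k - r k) := by
    have e1 : ρ + ∑ k ∈ s, r k = 1 := by
      rw [hρ, ← Finset.sum_add_distrib, ← hp]
      exact Finset.sum_congr rfl fun k _ => tsub_add_cancel_of_le (min_le_left _ _)
    have e2 : ∑ k ∈ s, (q k - r k) + ∑ k ∈ s, r k = 1 := by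
      rw [← Finset.sum_add_distrib, ← hq]
      exact Finset.sum_congr rfl fun k _ => tsub_add_cancel_of_le (min_le_right _ _)
    exact (ENNReal.add_left_inj hrt).1 (e1.trans e2.symm)
  have hρt : ρ ≠ ∞ := by
    refine ne_top_of_le_ne_top ENNReal.one_ne_top ?_
    rw [← hp]
    exact Finset.sum_le_sum fun k _ => tsub_le_self
  -- Components of weight zero need not be probability measures; conditioning on a null fibre gives
  -- the zero measure.
  have mass : ∀ (a x c : ℝ≥0∞), (a = 0 ∨ x = 1) → c ≤ a → c * x = c := by
    rintro a x c (rfl | rfl) hc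
    · rw [nonpos_iff_eq_zero.1 hc, zero_mul]
    · rw [mul_one]
  set A : Measure α := ∑ k ∈ s, (p k - r k) • κ k with hA
  set B : Measure α := ∑ k ∈ s, (q k - r k) • η k with hB
  have hAu : A Set.univ = ρ := by
    rw [hA, hρ, Measure.finsetSum_apply]
    exact Finset.sum_congr rfl fun k _ => mass _ _ _ (hκ k) tsub_le_self
  have hBu : B Set.univ = ρ := by
    rw [hB, hρ', Measure.finsetSum_apply]
    exact Finset.sum_congr rfl fun k _ => mass _ _ _ (hη k) tsub_le_self
  have : IsFiniteMeasure A := ⟨by rw [hAu]; exact hρt.lt_top⟩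
  have : IsFiniteMeasure B := ⟨by rw [hBu]; exact hρt.lt_top⟩
  have cancel : ∀ C : Measure α, C Set.univ = ρ → ρ⁻¹ • ρ • C = C := by
    intro C hC
    by_cases h0 : ρ = 0
    · rw [h0, Measure.measure_univ_eq_zero] at hC
      simp [hC]
    · rw [smul_smul, ENNReal.inv_mul_cancel h0 hρt, one_smul]
  -- On the overlap both coordinates use the same index `k`, and there `E` is null. The leftovers
  -- `A` and `B`, of mass `ρ` each, are coupled independently and normalised by `ρ⁻¹`, so at most
  -- `ρ` falls in `E`. If `ρ = 0` they vanish and the value of `ρ⁻¹` is immaterial.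
  refine ⟨∑ k ∈ s, r k • (κ k).prod (η k) + ρ⁻¹ • A.prod B, ?_, ?_, ?_⟩
  · rw [Measure.map_add _ _ measurable_fst, Measure.map_smul, Measure.map_fst_prod, hBu,
      cancel A hAu, Measure.map_finset_sum measurable_fst.aemeasurable, hA,
      ← Finset.sum_add_distrib]
    refine Finset.sum_congr rfl fun k _ => ?_
    rw [Measure.map_smul, Measure.map_fst_prod, smul_smul, mass _ _ _ (hη k) (min_le_right _ _),
      ← add_smul, add_tsub_cancel_of_le (min_le_left _ _)]
  · rw [Measure.map_add _ _ measurable_snd, Measure.map_smul, Measure.map_snd_prod, hAu,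
      cancel B hBu, Measure.map_finset_sum measurable_snd.aemeasurable, hB,
      ← Finset.sum_add_distrib]
    refine Finset.sum_congr rfl fun k _ => ?_
    rw [Measure.map_smul, Measure.map_snd_prod, smul_smul, mass _ _ _ (hκ k) (min_le_left _ _),
      ← add_smul, add_tsub_cancel_of_le (min_le_right _ _)]
  · intro E hE
    have h1 : (∑ k ∈ s, r k • (κ k).prod (η k)) E = 0 := by
      rw [Measure.finsetSum_apply]
      refine Finset.sum_eq_zero fun k hk => ?_
      rw [Measure.smul_apply, hE k hk, smul_zero]
    rw [Measure.add_apply, h1, zero_add, Measure.smul_apply, smul_eq_mul]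
    have h2 : A.prod B E ≤ ρ * ρ := by
      refine (measure_mono (Set.subset_univ E)).trans ?_
      rw [← Set.univ_prod_univ, Measure.prod_prod, hAu, hBu]
    calc ρ⁻¹ * A.prod B E ≤ ρ⁻¹ * (ρ * ρ) := by gcongr
      _ ≤ 1 * ρ := by
        rw [← mul_assoc]
        gcongr
        exact ENNReal.inv_mul_le_one ρ
      _ = ∑ k ∈ s, (p k - q k) := by
        rw [one_mul, hρ]
        refine Finset.sum_congr rfl fun k _ => ?_
        rcases le_total (p k) (q k) with h | h
        · simp [hr, h, tsub_eq_zero_of_le h]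
        · simp [hr, h]

theorem sum_restrict_fibre {τ : I → ℕ} (hτ : Measurable τ) {m : ℕ} (hm : ∀ x, τ x < m)
    (μ : Measure I) : ∑ k ∈ Finset.range m, μ.restrict (τ ⁻¹' {k}) = μ := by
  have hd : Pairwise (Function.onFun Disjoint fun k => τ ⁻¹' {k}) := fun i j hij =>
    Disjoint.preimage _ (by simpa using hij)
  ext E hE
  rw [Measure.finsetSum_apply]
  simp_rw [Measure.restrict_apply hE]
  rw [← measure_biUnion_finset]
  · congr 1
    ext x
    simpa using fun _ => hm x
  · intro i _ j _ hij
    exact (hd hij).mono Set.inter_subset_right Set.inter_subset_right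
  · exact fun k _ => hE.inter (hτ (measurableSet_singleton k))

/-- Two maps of `[0,1]` to a finite set agree, up to measure preserving changes of variables,
outside a set whose size is bounded by the distance of their laws. -/
theorem exists_coupling {τ ρ : I → ℕ} (hτ : Measurable τ) (hρ : Measurable ρ) {m : ℕ}
    (hτm : ∀ x, τ x < m) (hρm : ∀ x, ρ x < m) :
    ∃ φ ψ : I → I, MeasurePreserving φ ∧ MeasurePreserving ψ ∧
      volume.real {t | τ (φ t) ≠ ρ (ψ t)} ≤ ∑ k ∈ Finset.range m,
        |volume.real (τ ⁻¹' {k}) - volume.real (ρ ⁻¹' {k})| := by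
  have hms : ∀ {τ : I → ℕ}, Measurable τ → ∀ k, MeasurableSet (τ ⁻¹' {k}) :=
    fun h k => h (measurableSet_singleton k)
  have hmass : ∀ {τ : I → ℕ}, Measurable τ → ∀ k, volume (τ ⁻¹' {k}) = 0 ∨
      (volume : Measure I)[|τ ⁻¹' {k}] Set.univ = 1 := by
    intro τ hτ k
    by_cases h : volume (τ ⁻¹' {k}) = 0
    · exact Or.inl h
    · have := cond_isProbabilityMeasure (μ := (volume : Measure I)) h
      exact Or.inr measure_univ
  have hsum : ∀ {τ : I → ℕ}, Measurable τ → (∀ x, τ x < m) →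
      ∑ k ∈ Finset.range m, volume (τ ⁻¹' {k}) • (volume : Measure I)[|τ ⁻¹' {k}] = volume := by
    intro τ hτ hτm
    refine Eq.trans (Finset.sum_congr rfl fun k _ => ?_) (sum_restrict_fibre hτ hτm volume)
    by_cases h : volume (τ ⁻¹' {k}) = 0
    · rw [h, zero_smul, Measure.restrict_eq_zero.2 h]
    · rw [ProbabilityTheory.cond, smul_smul, ENNReal.mul_inv_cancel h (measure_ne_top _ _),
        one_smul]
  have hone : ∀ {τ : I → ℕ}, Measurable τ → (∀ x, τ x < m) →
      ∑ k ∈ Finset.range m, volume (τ ⁻¹' {k}) = 1 := by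
    intro τ hτ hτm
    have := congrArg (fun μ : Measure I => μ Set.univ) (sum_restrict_fibre hτ hτm volume)
    simpa [Measure.finsetSum_apply] using this
  -- Lebesgue measure is the mixture of its conditional laws on the fibres of `τ`, and likewise on
  -- those of `ρ`. Both marginals of the coupling are therefore Lebesgue measure, and its
  -- exceptional mass is governed by the label laws alone.
  obtain ⟨μ, h1, h2, h3⟩ := exists_mixture_coupling (Finset.range m)
    (fun k => (volume : Measure I)[|τ ⁻¹' {k}]) (fun k => (volume : Measure I)[|ρ ⁻¹' {k}])
    (fun k => volume (τ ⁻¹' {k})) (fun k => volume (ρ ⁻¹' {k})) (hmass hτ) (hmass hρ)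
    (hone hτ hτm) (hone hρ hρm)
  rw [hsum hτ hτm] at h1
  rw [hsum hρ hρm] at h2
  have : IsProbabilityMeasure μ := ⟨by
    rw [← Set.preimage_univ (f := Prod.fst), ← Measure.map_apply measurable_fst MeasurableSet.univ,
      h1, measure_univ]⟩
  -- The coupling is realised on `[0,1]` itself: the coordinates of `e` are the two measure
  -- preserving maps.
  obtain ⟨e, he, hev⟩ := Measure.exists_measurable_map_eq μ
  have hE : MeasurableSet {z : I × I | τ z.1 ≠ ρ z.2} :=
    (measurableSet_eq_fun (hτ.comp measurable_fst) (hρ.comp measurable_snd)).compl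
  refine ⟨fun t => (e t).1, fun t => (e t).2, ⟨by fun_prop, ?_⟩, ⟨by fun_prop, ?_⟩, ?_⟩
  · exact (Measure.map_map measurable_fst he).symm.trans (hev ▸ h1)
  · exact (Measure.map_map measurable_snd he).symm.trans (hev ▸ h2)
  · have e1 : volume {t | τ (e t).1 ≠ ρ (e t).2} = μ {z : I × I | τ z.1 ≠ ρ z.2} := by
      rw [← hev, Measure.map_apply he hE]
      rfl
    have e2 := h3 {z : I × I | τ z.1 ≠ ρ z.2} fun k _ => by
      have c1 := ae_cond_mem (μ := (volume : Measure I)) (hms hτ k)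
      have c2 := ae_cond_mem (μ := (volume : Measure I)) (hms hρ k)
      have d1 := Measure.quasiMeasurePreserving_fst
        (μ := (volume : Measure I)[|τ ⁻¹' {k}]) (ν := (volume : Measure I)[|ρ ⁻¹' {k}]) |>.ae c1
      have d2 := Measure.quasiMeasurePreserving_snd
        (μ := (volume : Measure I)[|τ ⁻¹' {k}]) (ν := (volume : Measure I)[|ρ ⁻¹' {k}]) |>.ae c2
      have : ∀ᵐ z ∂((volume : Measure I)[|τ ⁻¹' {k}]).prod ((volume : Measure I)[|ρ ⁻¹' {k}]),
          ¬ (τ z.1 ≠ ρ z.2) := by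
        filter_upwards [d1, d2] with z hz1 hz2
        simp only [Set.mem_preimage, Set.mem_singleton_iff] at hz1 hz2
        simp [hz1, hz2]
      simpa [ae_iff] using this
    rw [Measure.real, e1]
    refine ENNReal.toReal_le_of_le_ofReal (Finset.sum_nonneg fun k _ => abs_nonneg _)
      (e2.trans ?_)
    rw [ENNReal.ofReal_sum_of_nonneg fun k _ => abs_nonneg _]
    refine Finset.sum_le_sum fun k _ => ?_
    rw [← ENNReal.ofReal_toReal (measure_ne_top volume (τ ⁻¹' {k})),
      ← ENNReal.ofReal_toReal (measure_ne_top volume (ρ ⁻¹' {k})),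
      ← ENNReal.ofReal_sub _ ENNReal.toReal_nonneg]
    exact ENNReal.ofReal_le_ofReal (le_abs_self _)

/-! ## Approximation by step functions -/

theorem abs_sub_div_le_of_blockIndex {n : ℕ} (hn : 0 < n) (x : I) :
    |(x : ℝ) - (blockIndex n x : ℝ) / n| ≤ 1 / n := by
  have hn' : (0 : ℝ) < n := by exact_mod_cast hn
  have hx : 0 ≤ (n : ℝ) * (x : ℝ) := mul_nonneg hn'.le x.2.1
  have h1 : (blockIndex n x : ℝ) ≤ n * x :=
    le_trans (by exact_mod_cast min_le_left _ _) (Nat.floor_le hx)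
  have h2 : (n : ℝ) * x ≤ blockIndex n x + 1 := by
    unfold blockIndex
    rcases le_total ⌊(n : ℝ) * (x : ℝ)⌋₊ (n - 1) with h | h
    · rw [min_eq_left h]
      exact (Nat.lt_floor_add_one _).le
    · rw [min_eq_right h]
      have : ((n - 1 : ℕ) : ℝ) + 1 = n := by
        rw [Nat.cast_sub hn]
        simp
      rw [this]
      exact mul_le_of_le_one_right hn'.le x.2.2
  have e : (x : ℝ) - (blockIndex n x : ℝ) / n = (n * x - blockIndex n x) / n := by
    field_simp
  rw [e, abs_div, abs_of_pos hn', div_le_div_iff_of_pos_right hn', abs_of_nonneg (by linarith)]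
  linarith

/-- Step functions on a uniform grid are dense in `L¹` of the unit square. -/
theorem exists_blockFun_integral_le {F : I → I → ℝ} (hF : Integrable fun p : I × I => F p.1 p.2)
    {ε : ℝ} (hε : 0 < ε) : ∃ (m : ℕ) (c : ℕ → ℕ → ℝ) (C : ℝ), 0 < m ∧ (∀ k l, |c k l| ≤ C) ∧
      ∫ p : I × I, |F p.1 p.2 - blockFun m c p.1 p.2| ≤ ε := by
  obtain ⟨G, hG, hGi⟩ := hF.exists_boundedContinuous_integral_sub_le (half_pos hε)
  have huc : UniformContinuous G := CompactSpace.uniformContinuous_of_continuous G.continuous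
  obtain ⟨δ, hδ, hGδ⟩ := Metric.uniformContinuous_iff.1 huc (ε / 2) (half_pos hε)
  obtain ⟨N, hN⟩ := exists_nat_one_div_lt hδ
  set m : ℕ := N + 1
  have hm : 0 < m := Nat.succ_pos N
  -- Left endpoints of the blocks; the projection only makes `pt` total for `k > m`.
  let pt : ℕ → I := fun k => Set.projIcc 0 1 zero_le_one ((k : ℝ) / m)
  have hpt : ∀ x : I, dist x (pt (blockIndex m x)) < δ := by
    intro x
    have hmem : (blockIndex m x : ℝ) / m ∈ I := by
      refine ⟨by positivity, (div_le_one (by exact_mod_cast hm)).2 ?_⟩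
      exact_mod_cast (blockIndex_lt hm x).le
    have : pt (blockIndex m x) = ⟨(blockIndex m x : ℝ) / m, hmem⟩ :=
      Set.projIcc_of_mem zero_le_one hmem
    rw [this, Subtype.dist_eq, Real.dist_eq]
    refine (abs_sub_div_le_of_blockIndex hm x).trans_lt ?_
    simpa [m] using hN
  refine ⟨m, fun k l => G (pt k, pt l), ‖G‖, hm, fun k l => G.norm_coe_le_norm _, ?_⟩
  have hb := measurable_blockFun m fun k l => G (pt k, pt l)
  have hclose : ∀ p : I × I, |G p - blockFun m (fun k l => G (pt k, pt l)) p.1 p.2| ≤ ε / 2 := by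
    intro p
    have := hGδ (a := p) (b := (pt (blockIndex m p.1), pt (blockIndex m p.2)))
      (by rw [Prod.dist_eq]; exact max_lt (hpt _) (hpt _))
    rw [Real.dist_eq] at this
    exact this.le
  have i1 : Integrable fun p : I × I => G p - blockFun m (fun k l => G (pt k, pt l)) p.1 p.2 :=
    Integrable.of_bound (G.continuous.measurable.sub hb).aestronglyMeasurable (ε / 2)
      (ae_of_all _ hclose)
  have i2 : Integrable fun p : I × I => F p.1 p.2 - G p := hF.sub hGi
  calc ∫ p : I × I, |F p.1 p.2 - blockFun m (fun k l => G (pt k, pt l)) p.1 p.2|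
      ≤ ∫ p : I × I, (|F p.1 p.2 - G p|
          + |G p - blockFun m (fun k l => G (pt k, pt l)) p.1 p.2|) := by
        refine integral_mono_of_nonneg (ae_of_all _ fun p => abs_nonneg _)
          (i2.abs.add i1.abs) (ae_of_all _ fun p => ?_)
        exact abs_sub_le _ _ _
    _ = (∫ p : I × I, |F p.1 p.2 - G p|)
          + ∫ p : I × I, |G p - blockFun m (fun k l => G (pt k, pt l)) p.1 p.2| :=
        integral_add i2.abs i1.abs
    _ ≤ ε / 2 + ∫ _ : I × I, ε / 2 :=
        add_le_add hG (integral_mono i1.abs (integrable_const _) hclose)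
    _ = ε := by simp

/-! ## Distance of a truncation from a kernel -/

/-- The integrand is at most `2 * C` and vanishes unless one of the two coordinates lies in the
disagreement set; the two strips over that set have total measure at most twice its measure. -/
theorem integral_abs_sub_le_of_agree {c : ℕ → ℕ → ℝ} {C : ℝ} (hc : ∀ k l, |c k l| ≤ C)
    {τ ρ : I → ℕ} (hτ : Measurable τ) (hρ : Measurable ρ) :
    ∫ p : I × I, |c (τ p.1) (τ p.2) - c (ρ p.1) (ρ p.2)| ≤
      4 * C * volume.real {t | τ t ≠ ρ t} := by
  have hC : 0 ≤ C := (abs_nonneg _).trans (hc 0 0)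
  have hB : MeasurableSet {t | τ t ≠ ρ t} := (measurableSet_eq_fun hτ hρ).compl
  set B := {t | τ t ≠ ρ t}
  have hi : Integrable (B.indicator fun _ : I => (1 : ℝ)) := (integrable_const _).indicator hB
  have h1 : ∫ t, B.indicator (fun _ : I => (1 : ℝ)) t = volume.real B := by
    rw [integral_indicator hB, setIntegral_const, smul_eq_mul, mul_one]
  have mp1 := measurePreserving_fst (μ := (volume : Measure I)) (ν := (volume : Measure I))
  have mp2 := measurePreserving_snd (μ := (volume : Measure I)) (ν := (volume : Measure I))
  have j1 : Integrable fun p : I × I => B.indicator (fun _ : I => (1 : ℝ)) p.1 :=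
    mp1.integrable_comp_of_integrable hi
  have j2 : Integrable fun p : I × I => B.indicator (fun _ : I => (1 : ℝ)) p.2 :=
    mp2.integrable_comp_of_integrable hi
  have e1 : ∫ p : I × I, B.indicator (fun _ : I => (1 : ℝ)) p.1 = volume.real B := by
    rw [Measure.volume_eq_prod, integral_fun_fst (B.indicator fun _ : I => (1 : ℝ)), h1]
    simp
  have e2 : ∫ p : I × I, B.indicator (fun _ : I => (1 : ℝ)) p.2 = volume.real B := by
    rw [Measure.volume_eq_prod, integral_fun_snd (B.indicator fun _ : I => (1 : ℝ)), h1]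
    simp
  calc ∫ p : I × I, |c (τ p.1) (τ p.2) - c (ρ p.1) (ρ p.2)|
      ≤ ∫ p : I × I, 2 * C * (B.indicator (fun _ : I => (1 : ℝ)) p.1
          + B.indicator (fun _ : I => (1 : ℝ)) p.2) := by
        refine integral_mono_of_nonneg (ae_of_all _ fun p => abs_nonneg _)
          ((j1.add j2).const_mul _) (ae_of_all _ fun p => ?_)
        beta_reduce
        have b1 : |c (τ p.1) (τ p.2) - c (ρ p.1) (ρ p.2)| ≤ 2 * C :=
          (abs_sub _ _).trans (by linarith [hc (τ p.1) (τ p.2), hc (ρ p.1) (ρ p.2)])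
        have n1 : (0 : ℝ) ≤ B.indicator (fun _ : I => (1 : ℝ)) p.1 :=
          Set.indicator_nonneg (fun _ _ => zero_le_one) _
        have n2 : (0 : ℝ) ≤ B.indicator (fun _ : I => (1 : ℝ)) p.2 :=
          Set.indicator_nonneg (fun _ _ => zero_le_one) _
        by_cases a1 : p.1 ∈ B
        · rw [Set.indicator_of_mem a1]
          nlinarith
        · by_cases a2 : p.2 ∈ B
          · rw [Set.indicator_of_mem a2]
            nlinarith
          · rw [Set.indicator_of_notMem a1, Set.indicator_of_notMem a2]
            simp only [B, Set.mem_ofPred_eq, not_not] at a1 a2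
            simp [a1, a2]
    _ = 4 * C * volume.real B := by
        rw [integral_const_mul, integral_add j1 j2, e1, e2]
        ring

/-- The law of a labelling of the blocks. -/
theorem volume_label_blockIndex {n : ℕ} (hn : 0 < n) (y : ℕ → ℕ) (k : ℕ) :
    volume.real ((fun t : I => y (blockIndex n t)) ⁻¹' {k}) =
      (((Finset.range n).filter fun i => y i = k).card : ℝ) / n := by
  have : (fun t : I => y (blockIndex n t)) ⁻¹' {k} =
      ⋃ i ∈ (Finset.range n).filter (fun i => y i = k), blockIndex n ⁻¹' {i} := by
    ext t
    simp [blockIndex_lt hn t]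
  rw [this, measureReal_biUnion_finset, Finset.sum_congr rfl fun i hi =>
    volume_blockIndex_eq (Finset.mem_range.1 (Finset.mem_filter.1 hi).1)]
  · simp [div_eq_mul_inv]
  · intro i _ j _ hij
    exact Disjoint.preimage _ (by simpa using hij)
  · exact fun i _ => measurable_blockIndex n (measurableSet_singleton i)

theorem abs_matrixEntry_le (a : Pair → Set.Icc (-1 : ℝ) 1) (i j : ℕ) :
    |matrixEntry a i j| ≤ 1 := by
  unfold matrixEntry
  split_ifs
  · exact abs_le.2 (a _).2
  · simp

/-- The distance of a truncated array `a` from a kernel `W` is bounded by the cut norm of the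
deviation of `a i j` from `W (x i) (x j)`, by the quality of a step function approximation of `W`,
on the square and on the sample `x`, and by the discrepancy of the sample. -/
theorem cutDist_stepFun_le (W : SymmKernel) (a : Pair → Set.Icc (-1 : ℝ) 1) (x : ℕ → I)
    {n m : ℕ} (hn : 0 < n) (hm : 0 < m) {c : ℕ → ℕ → ℝ} {C : ℝ} (hc : ∀ k l, |c k l| ≤ C)
    {ε₁ ε₂ ε₃ δ : ℝ}
    (h₁ : ∀ S ⊆ Finset.range n, ∀ T ⊆ Finset.range n,
      |∑ i ∈ S, ∑ j ∈ T, if i = j then 0 else matrixEntry a i j - W.1 (x i) (x j)|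
        ≤ ε₁ * (n : ℝ) ^ 2)
    (h₂ : ∑ i ∈ Finset.range n, ∑ j ∈ Finset.range n,
      (if i = j then 0 else |W.1 (x i) (x j) - blockFun m c (x i) (x j)|) ≤ ε₂ * (n : ℝ) ^ 2)
    (h₃ : ∫ p : I × I, |W.1 p.1 p.2 - blockFun m c p.1 p.2| ≤ ε₃)
    (hδ : ∑ k ∈ Finset.range m,
      |(((Finset.range n).filter fun i => blockIndex m (x i) = k).card : ℝ) / n - 1 / m| ≤ δ) :
    cutDist ⟨stepFun n a, isKernel_stepFun n a⟩ W ≤ ε₁ + (ε₂ + C / n) + 4 * C * δ + ε₃ := by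
  have hC : 0 ≤ C := (abs_nonneg _).trans (hc 0 0)
  have hn' : (0 : ℝ) < n := by exact_mod_cast hn
  set y : ℕ → ℕ := fun i => blockIndex m (x i) with hy
  have hbn := measurable_blockIndex n
  have hbm := measurable_blockIndex m
  have hτ : Measurable fun t : I => y (blockIndex n t) := (measurable_of_countable y).comp hbn
  -- After pullback, the label of the sample point attached to `φ t` agrees with the grid label of
  -- `ψ t` outside a set of measure at most `δ`.
  obtain ⟨φ, ψ, hφ, hψ, hagree⟩ := exists_coupling hτ hbm (m := m)
    (fun t => blockIndex_lt hm _) (fun t => blockIndex_lt hm _)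
  have hagree' : volume.real {t | y (blockIndex n (φ t)) ≠ blockIndex m (ψ t)} ≤ δ := by
    refine hagree.trans (le_trans (le_of_eq ?_) hδ)
    refine Finset.sum_congr rfl fun k hk => ?_
    rw [volume_label_blockIndex hn y k, volume_blockIndex_eq (Finset.mem_range.1 hk)]
  set N : ℕ → ℕ → ℝ := fun i j => if i = j then 0 else matrixEntry a i j - W.1 (x i) (x j) with hN
  -- The step function of the array has zero diagonal, so the sampled `c` must be removed there.
  -- These `n` entries of size at most `C` produce the term `C / n`.
  set D : ℕ → ℕ → ℝ := fun i j => if i = j then -c (y i) (y j) else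
    W.1 (x i) (x j) - c (y i) (y j) with hD
  have bN : ∀ i j, |N i j| ≤ 2 + C := by
    intro i j
    simp only [hN]
    split_ifs
    · simpa using by linarith
    · have := abs_sub (matrixEntry a i j) (W.1 (x i) (x j))
      linarith [abs_matrixEntry_le a i j, W.abs_le (x i) (x j)]
  have bD : ∀ i j, |D i j| ≤ 2 + C := by
    intro i j
    simp only [hD]
    split_ifs
    · rw [abs_neg]
      linarith [hc (y i) (y j)]
    · have := abs_sub (W.1 (x i) (x j)) (c (y i) (y j))
      linarith [hc (y i) (y j), W.abs_le (x i) (x j)]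
  -- The difference telescopes into edge noise, approximation error on the sample, mismatch of
  -- labels, and approximation error on the square. `F₃` involves both maps and is pulled back from
  -- the start; the other three are pulled back by `φ` or `ψ` below.
  let F₁ : I → I → ℝ := blockFun n N
  let F₂ : I → I → ℝ := blockFun n D
  let F₃ : I → I → ℝ := fun s t =>
    c (y (blockIndex n (φ s))) (y (blockIndex n (φ t))) - c (blockIndex m (ψ s)) (blockIndex m (ψ t))
  let F₄ : I → I → ℝ := fun s t => blockFun m c s t - W.1 s t
  have m₁ : Measurable fun p : I × I => F₁ p.1 p.2 := measurable_blockFun n N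
  have m₂ : Measurable fun p : I × I => F₂ p.1 p.2 := measurable_blockFun n D
  have m₃ : Measurable fun p : I × I => F₃ p.1 p.2 :=
    (measurable_comp_nat (hτ.comp hφ.measurable) (hτ.comp hφ.measurable) c).sub
      (measurable_comp_nat (hbm.comp hψ.measurable) (hbm.comp hψ.measurable) c)
  have m₄ : Measurable fun p : I × I => F₄ p.1 p.2 := (measurable_blockFun m c).sub W.2.measurable
  have b₃ : ∀ s t, |F₃ s t| ≤ 2 * C := fun s t => (abs_sub _ _).trans (by
    linarith [hc (y (blockIndex n (φ s))) (y (blockIndex n (φ t))),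
      hc (blockIndex m (ψ s)) (blockIndex m (ψ t))])
  have b₄ : ∀ s t, |F₄ s t| ≤ 2 + C := fun s t => (abs_sub _ _).trans (by
    have := hc (blockIndex m s) (blockIndex m t)
    have := W.abs_le s t
    simp only [blockFun]
    linarith)
  have n₁ : cutNorm F₁ ≤ ε₁ := cutNorm_blockFun_le hn h₁
  have n₂ : cutNorm F₂ ≤ ε₂ + C / n := by
    refine (cutNorm_le_integral m₂ fun s t => bD _ _).trans ?_
    have : ∫ p : I × I, |F₂ p.1 p.2| = ∫ p : I × I, blockFun n (fun i j => |D i j|) p.1 p.2 := rfl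
    rw [this, integral_blockFun hn, div_le_iff₀ (by positivity)]
    have e : ∀ i ∈ Finset.range n, ∑ j ∈ Finset.range n, |D i j| ≤
        ∑ j ∈ Finset.range n,
          (if i = j then 0 else |W.1 (x i) (x j) - blockFun m c (x i) (x j)|) + C := by
      intro i hi
      calc ∑ j ∈ Finset.range n, |D i j| ≤ ∑ j ∈ Finset.range n,
            ((if i = j then 0 else |W.1 (x i) (x j) - blockFun m c (x i) (x j)|)
              + if i = j then C else 0) := by
            refine Finset.sum_le_sum fun j _ => ?_
            simp only [hD]
            split_ifs
            · rw [abs_neg, zero_add]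
              exact hc _ _
            · rw [add_zero]
              rfl
        _ = _ := by
            rw [Finset.sum_add_distrib, Finset.sum_ite_eq, if_pos hi]
    refine (Finset.sum_le_sum e).trans ?_
    rw [Finset.sum_add_distrib, Finset.sum_const, Finset.card_range, nsmul_eq_mul]
    have : (n : ℝ) * C = C / n * n ^ 2 := by field_simp
    linarith
  have n₃ : cutNorm F₃ ≤ 4 * C * δ := by
    refine (cutNorm_le_integral m₃ b₃).trans ?_
    refine (integral_abs_sub_le_of_agree hc (hτ.comp hφ.measurable)
      (hbm.comp hψ.measurable)).trans ?_
    exact mul_le_mul_of_nonneg_left hagree' (by positivity)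
  have n₄ : cutNorm F₄ ≤ ε₃ := by
    refine (cutNorm_le_integral m₄ b₄).trans (le_trans (le_of_eq ?_) h₃)
    simp only [F₄, abs_sub_comm]
  have p₁ := cutNorm_pullback_le m₁ (fun s t => bN _ _) hφ
  have p₂ := cutNorm_pullback_le m₂ (fun s t => bD _ _) hφ
  have p₄ := cutNorm_pullback_le m₄ b₄ hψ
  have pullm : ∀ {F : I → I → ℝ} {γ : I → I}, (Measurable fun p : I × I => F p.1 p.2) →
      Measurable γ → Measurable fun p : I × I => F (γ p.1) (γ p.2) := fun {F γ} hF hγ =>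
    hF.comp (f := fun p : I × I => (γ p.1, γ p.2)) (by fun_prop)
  have M₁ := pullm m₁ hφ.measurable
  have M₂ := pullm m₂ hφ.measurable
  have M₄ := pullm m₄ hψ.measurable
  have s₁ := cutNorm_add_le (C := 2 + C) (A := fun s t => F₁ (φ s) (φ t))
    (B := fun s t => F₂ (φ s) (φ t)) M₁ M₂ (fun s t => bN _ _) (fun s t => bD _ _)
  have s₂ := cutNorm_add_le (C := 2 + 2 * C) (A := F₃)
    (B := fun s t => F₄ (ψ s) (ψ t)) m₃ M₄ (fun s t => (b₃ s t).trans (by linarith))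
    (fun s t => (b₄ _ _).trans (by linarith))
  have s₃ := cutNorm_add_le (C := 2 * (2 + 2 * C))
    (A := fun s t => F₁ (φ s) (φ t) + F₂ (φ s) (φ t))
    (B := fun s t => F₃ s t + F₄ (ψ s) (ψ t)) (M₁.add M₂) (m₃.add M₄)
    (fun s t => (abs_add_le _ _).trans (by
      linarith [bN (blockIndex n (φ s)) (blockIndex n (φ t)),
        bD (blockIndex n (φ s)) (blockIndex n (φ t)), hC,
        show |F₁ (φ s) (φ t)| = |N (blockIndex n (φ s)) (blockIndex n (φ t))| from rfl,
        show |F₂ (φ s) (φ t)| = |D (blockIndex n (φ s)) (blockIndex n (φ t))| from rfl]))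
    (fun s t => (abs_add_le _ _).trans (by linarith [b₃ s t, b₄ (ψ s) (ψ t)]))
  refine (cutDist_le _ W hφ hψ).trans ?_
  have eq : (fun s t => stepFun n a (φ s) (φ t) - W.1 (ψ s) (ψ t)) =
      fun s t => F₁ (φ s) (φ t) + F₂ (φ s) (φ t) + (F₃ s t + F₄ (ψ s) (ψ t)) := by
    funext s t
    simp only [F₁, F₂, F₃, F₄, blockFun, hN, hD, stepFun]
    split_ifs with h
    · rw [h]
      simp only [matrixEntry, ne_eq, not_true_eq_false, dite_false]
      ring
    · ring
  rw [eq]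
  linarith

/-! ## Averages over pairs of an i.i.d. sample -/

theorem ae_eventually_notMem_of_summable {Ω : Type*} [MeasurableSpace Ω] {P : Measure Ω}
    [IsProbabilityMeasure P] {s : ℕ → Set Ω} {b : ℕ → ℝ} (hb : Summable b)
    (h : ∀ n, P.real (s n) ≤ b n) : ∀ᵐ ω ∂P, ∀ᶠ n in atTop, ω ∉ s n := by
  refine ae_eventually_notMem (ne_top_of_le_ne_top hb.tsum_ofReal_ne_top ?_)
  refine ENNReal.tsum_le_tsum fun n => ?_
  rw [← ENNReal.ofReal_toReal (measure_ne_top P (s n))]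
  exact ENNReal.ofReal_le_ofReal (h n)

/-- Independent uniform random variables. -/
structure IsUniformSample {Ω ι : Type*} [MeasurableSpace Ω] (P : Measure Ω) (X : ι → Ω → I) :
    Prop where
  measurable : ∀ i, Measurable (X i)
  uniform : ∀ i, P.map (X i) = volume
  indep : iIndepFun X P

section Sample

variable {Ω : Type*} [MeasurableSpace Ω] {P : Measure Ω}

theorem IsUniformSample.measurePreserving {ι : Type*} {X : ι → Ω → I} (hX : IsUniformSample P X)
    (i : ι) : MeasurePreserving (X i) P volume := ⟨hX.measurable i, hX.uniform i⟩

/-- The empirical frequencies of the blocks converge. -/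
theorem ae_tendsto_block_frequency {X : ℕ → Ω → I} (hX : IsUniformSample P X) {m k : ℕ}
    (hk : k < m) : ∀ᵐ ω ∂P, Tendsto (fun n : ℕ =>
      (((Finset.range n).filter fun i => blockIndex m (X i ω) = k).card : ℝ) / n)
        atTop (𝓝 (1 / m)) := by
  have hB : MeasurableSet (blockIndex m ⁻¹' {k}) :=
    measurable_blockIndex m (measurableSet_singleton k)
  let g : I → ℝ := (blockIndex m ⁻¹' {k}).indicator fun _ => 1
  have hg : Measurable g := measurable_const.indicator hB
  have hgi : Integrable g := (integrable_const _).indicator hB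
  have e0 : ∫ ω, g (X 0 ω) ∂P = 1 / m := by
    rw [← integral_map (hX.measurable 0).aemeasurable hg.aestronglyMeasurable, hX.uniform,
      integral_indicator hB, setIntegral_const, volume_blockIndex_eq hk, smul_eq_mul, mul_one]
  have := strong_law_ae_real (μ := P) (fun i ω => g (X i ω))
    ((hX.measurePreserving 0).integrable_comp_of_integrable hgi)
    (fun i j hij => (hX.indep.indepFun hij).comp hg hg)
    (fun i => IdentDistrib.comp ⟨(hX.measurable i).aemeasurable, (hX.measurable 0).aemeasurable,
      by rw [hX.uniform, hX.uniform]⟩ hg)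
  rw [e0] at this
  filter_upwards [this] with ω hω
  refine hω.congr fun n => ?_
  congr 1
  rw [Finset.card_filter]
  push_cast
  refine Finset.sum_congr rfl fun i _ => ?_
  by_cases h : blockIndex m (X i ω) = k
  · simp [g, h]
  · simp [g, h]

variable [IsProbabilityMeasure P]

theorem IsUniformSample.measurePreserving_pair {ι : Type*} {X : ι → Ω → I}
    (hX : IsUniformSample P X) {i j : ι} (hij : i ≠ j) :
    MeasurePreserving (fun ω => (X i ω, X j ω)) P volume := by
  refine ⟨(hX.measurable i).prodMk (hX.measurable j), ?_⟩
  rw [(indepFun_iff_map_prod_eq_prod_map_map (hX.measurable i).aemeasurable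
    (hX.measurable j).aemeasurable).1 (hX.indep.indepFun hij), hX.uniform, hX.uniform]
  rfl

/-- The second moment of a sum over pairs of centred functions. -/
theorem integral_sq_sum_pairs_le {X : ℕ → Ω → I} (hX : IsUniformSample P X) {G : I × I → ℝ}
    (hG : Measurable G) {C : ℝ} (hb : ∀ p, |G p| ≤ C) (h0 : ∫ p, G p = 0) (N : ℕ) :
    ∫ ω, (∑ i ∈ Finset.range N, ∑ j ∈ Finset.range N,
      if i = j then 0 else G (X i ω, X j ω)) ^ 2 ∂P ≤ 4 * C ^ 2 * (N : ℝ) ^ 3 := by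
  set T : ℕ → ℕ → Ω → ℝ := fun i j ω => if i = j then 0 else G (X i ω, X j ω) with hT
  have hC : 0 ≤ C := (abs_nonneg _).trans (hb (0, 0))
  have mT : ∀ i j, Measurable (T i j) := by
    intro i j
    by_cases h : i = j
    · simp [hT, h]
    · simpa [hT, h, Function.comp_def] using
        hG.comp ((hX.measurable i).prodMk (hX.measurable j))
  have bT : ∀ i j ω, |T i j ω| ≤ C := by
    intro i j ω
    simp only [hT]
    split_ifs
    · simpa using hC
    · exact hb _
  have iT : ∀ i j k l, Integrable (fun ω => T i j ω * T k l ω) P := fun i j k l =>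
    Integrable.of_bound ((mT i j).mul (mT k l)).aestronglyMeasurable (C * C)
      (ae_of_all _ fun ω => by
        rw [Real.norm_eq_abs, abs_mul]
        exact mul_le_mul (bT _ _ _) (bT _ _ _) (abs_nonneg _) hC)
  have zero : ∀ i j, ∫ ω, T i j ω ∂P = 0 := by
    intro i j
    by_cases h : i = j
    · simp [hT, h]
    · simp only [hT, h, if_false]
      have mp := hX.measurePreserving_pair h
      rw [← h0, ← mp.map_eq, integral_map mp.measurable.aemeasurable hG.aestronglyMeasurable]
  -- Pairs with no common index give independent centred terms, so the covariance vanishes.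
  -- Otherwise at least one of the four indicators equals one and the trivial bound `C ^ 2`
  -- suffices. Each indicator contributes `N ^ 3` after summation.
  have cov : ∀ i j k l, ∫ ω, T i j ω * T k l ω ∂P ≤
      C ^ 2 * ((if i = k then 1 else 0) + (if i = l then 1 else 0) + (if j = k then 1 else 0)
        + (if j = l then 1 else 0)) := by
    intro i j k l
    by_cases h : i ≠ k ∧ i ≠ l ∧ j ≠ k ∧ j ≠ l
    · obtain ⟨h1, h2, h3, h4⟩ := h
      simp only [h1, h2, h3, h4, if_false, add_zero, mul_zero]
      refine le_of_eq ?_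
      by_cases hij : i = j
      · simp [hT, hij]
      by_cases hkl : k = l
      · simp [hT, hkl]
      have hind : T i j ⟂ᵢ[P] T k l := by
        have := (hX.indep.indepFun_prodMk_prodMk hX.measurable i j k l h1 h2 h3 h4).comp hG hG
        have e1 : T i j = G ∘ fun ω => (X i ω, X j ω) := by funext ω; simp [hT, hij]
        have e2 : T k l = G ∘ fun ω => (X k ω, X l ω) := by funext ω; simp [hT, hkl]
        rwa [e1, e2]
      rw [hind.integral_fun_mul_eq_mul_integral (mT i j).aestronglyMeasurable
        (mT k l).aestronglyMeasurable, zero, zero, mul_zero]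
    · have le1 : ∫ ω, T i j ω * T k l ω ∂P ≤ C ^ 2 := by
        have : ∫ ω, T i j ω * T k l ω ∂P ≤ ∫ _, C ^ 2 ∂P :=
          integral_mono (iT i j k l) (integrable_const _) fun ω => by
            refine (le_abs_self _).trans ?_
            rw [abs_mul, sq]
            exact mul_le_mul (bT _ _ _) (bT _ _ _) (abs_nonneg _) hC
        simpa using this
      have ge1 : (1 : ℝ) ≤ (if i = k then 1 else 0) + (if i = l then 1 else 0)
          + (if j = k then 1 else 0) + (if j = l then 1 else 0) := by
        have z : ∀ a b : ℕ, (0 : ℝ) ≤ if a = b then 1 else 0 := fun a b => by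
          split_ifs <;> norm_num
        by_cases a1 : i = k
        · rw [if_pos a1]
          linarith [z i l, z j k, z j l]
        by_cases a2 : i = l
        · rw [if_pos a2]
          linarith [z i k, z j k, z j l]
        by_cases a3 : j = k
        · rw [if_pos a3]
          linarith [z i k, z i l, z j l]
        by_cases a4 : j = l
        · rw [if_pos a4]
          linarith [z i k, z i l, z j k]
        exact absurd ⟨a1, a2, a3, a4⟩ h
      nlinarith [sq_nonneg C]
  have expand : ∀ ω, (∑ i ∈ Finset.range N, ∑ j ∈ Finset.range N, T i j ω) ^ 2 =
      ∑ i ∈ Finset.range N, ∑ j ∈ Finset.range N, ∑ k ∈ Finset.range N, ∑ l ∈ Finset.range N,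
        T i j ω * T k l ω := by
    intro ω
    simp_rw [sq, Finset.sum_mul, Finset.mul_sum]
  calc ∫ ω, (∑ i ∈ Finset.range N, ∑ j ∈ Finset.range N, T i j ω) ^ 2 ∂P
      = ∑ i ∈ Finset.range N, ∑ j ∈ Finset.range N, ∑ k ∈ Finset.range N,
          ∑ l ∈ Finset.range N, ∫ ω, T i j ω * T k l ω ∂P := by
        simp_rw [expand]
        rw [integral_finsetSum _ fun i _ => integrable_finsetSum _ fun j _ =>
          integrable_finsetSum _ fun k _ => integrable_finsetSum _ fun l _ => iT i j k l]
        refine Finset.sum_congr rfl fun i _ => ?_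
        rw [integral_finsetSum _ fun j _ => integrable_finsetSum _ fun k _ =>
          integrable_finsetSum _ fun l _ => iT i j k l]
        refine Finset.sum_congr rfl fun j _ => ?_
        rw [integral_finsetSum _ fun k _ => integrable_finsetSum _ fun l _ => iT i j k l]
        refine Finset.sum_congr rfl fun k _ => ?_
        rw [integral_finsetSum _ fun l _ => iT i j k l]
    _ ≤ ∑ i ∈ Finset.range N, ∑ j ∈ Finset.range N, ∑ k ∈ Finset.range N,
          ∑ l ∈ Finset.range N, C ^ 2 * ((if i = k then 1 else 0) + (if i = l then 1 else 0)
            + (if j = k then 1 else 0) + (if j = l then 1 else 0)) := by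
        gcongr with i _ j _ k _ l _
        exact cov i j k l
    _ = ∑ i ∈ Finset.range N, ∑ j ∈ Finset.range N, C ^ 2 * (4 * N) := by
        refine Finset.sum_congr rfl fun i hi => Finset.sum_congr rfl fun j hj => ?_
        simp_rw [← Finset.mul_sum, Finset.sum_add_distrib, Finset.sum_const, Finset.card_range,
          Finset.sum_ite_eq, if_pos hi, if_pos hj, nsmul_eq_mul, ← Finset.mul_sum,
          Finset.sum_ite_eq, if_pos hi, if_pos hj]
        ring
    _ = 4 * C ^ 2 * (N : ℝ) ^ 3 := by
        simp only [Finset.sum_const, Finset.card_range, nsmul_eq_mul]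
        ring

/-- The average of a nonnegative function over the pairs of a sample is asymptotically at most four
times its mean. -/
theorem ae_eventually_sum_pairs_le {X : ℕ → Ω → I} (hX : IsUniformSample P X) {F : I × I → ℝ}
    (hF : Measurable F) {C : ℝ} (h0 : ∀ p, 0 ≤ F p) (hb : ∀ p, F p ≤ C) {ε : ℝ} (hε : 0 < ε) :
    ∀ᵐ ω ∂P, ∀ᶠ n : ℕ in atTop, ∑ i ∈ Finset.range n, ∑ j ∈ Finset.range n,
      (if i = j then 0 else F (X i ω, X j ω)) ≤ 4 * ((∫ p, F p) + ε) * (n : ℝ) ^ 2 := by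
  set μ : ℝ := ∫ p, F p with hμ
  have hFi : Integrable F := Integrable.of_bound hF.aestronglyMeasurable C
    (ae_of_all _ fun p => by rw [Real.norm_eq_abs, abs_of_nonneg (h0 p)]; exact hb p)
  have μ0 : 0 ≤ μ := integral_nonneg h0
  have μC : μ ≤ C := by
    have : μ ≤ ∫ _ : I × I, C := integral_mono hFi (integrable_const _) hb
    simpa using this
  let G : I × I → ℝ := fun p => F p - μ
  have hG : Measurable G := hF.sub measurable_const
  have bG : ∀ p, |G p| ≤ C := fun p => abs_le.2
    ⟨by linarith [h0 p], by linarith [hb p]⟩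
  have zG : ∫ p, G p = 0 := by
    simp only [G]
    rw [integral_sub hFi (integrable_const _)]
    simp [hμ]
  let T : ℕ → Ω → ℝ := fun N ω => ∑ i ∈ Finset.range N, ∑ j ∈ Finset.range N,
    if i = j then 0 else G (X i ω, X j ω)
  have mT : ∀ N, Measurable (T N) := by
    intro N
    refine Finset.measurable_sum _ fun i _ => Finset.measurable_sum _ fun j _ => ?_
    by_cases h : i = j
    · simp [h]
    · simpa [h, Function.comp_def] using hG.comp ((hX.measurable i).prodMk (hX.measurable j))
  have bT : ∀ N ω, |T N ω| ≤ N * (N * C) := by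
    intro N ω
    have hC : 0 ≤ C := μ0.trans μC
    calc |T N ω| ≤ ∑ i ∈ Finset.range N, ∑ j ∈ Finset.range N, C := by
          refine (Finset.abs_sum_le_sum_abs _ _).trans (Finset.sum_le_sum fun i _ => ?_)
          refine (Finset.abs_sum_le_sum_abs _ _).trans (Finset.sum_le_sum fun j _ => ?_)
          split_ifs
          · simpa using hC
          · exact bG _
      _ = N * (N * C) := by simp
  -- The second moment bounds the exceptional probability at size `N` only by a multiple of `1 / N`,
  -- which is summable along powers of two but not along all integers.
  let s : ℕ → Set Ω := fun k => {ω | (ε * ((2 ^ k : ℕ) : ℝ) ^ 2) ^ 2 ≤ T (2 ^ k) ω ^ 2}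
  have hs : ∀ k, P.real (s k) ≤ 4 * C ^ 2 / ε ^ 2 * (1 / 2) ^ k := by
    intro k
    have hm := mul_meas_ge_le_integral_of_nonneg (μ := P) (f := fun ω => T (2 ^ k) ω ^ 2)
      (ae_of_all _ fun ω => sq_nonneg _)
      (Integrable.of_bound ((mT _).pow_const 2).aestronglyMeasurable
        ((((2 ^ k : ℕ) : ℝ) * (((2 ^ k : ℕ) : ℝ) * C)) ^ 2) (ae_of_all _ fun ω => by
          rw [Real.norm_eq_abs, abs_pow]
          exact pow_le_pow_left₀ (abs_nonneg _) (bT _ ω) 2))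
      ((ε * ((2 ^ k : ℕ) : ℝ) ^ 2) ^ 2)
    have hm2 := hm.trans (integral_sq_sum_pairs_le hX hG bG zG (2 ^ k))
    have hN : (0 : ℝ) < ((2 ^ k : ℕ) : ℝ) := by positivity
    have e : (1 / 2 : ℝ) ^ k = 1 / ((2 ^ k : ℕ) : ℝ) := by push_cast; simp
    rw [e]
    rw [mul_comm, ← le_div_iff₀ (by positivity)] at hm2
    refine hm2.trans (le_of_eq ?_)
    field_simp
  have hsum : Summable fun k : ℕ => 4 * C ^ 2 / ε ^ 2 * (1 / 2 : ℝ) ^ k :=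
    (summable_geometric_of_lt_one (by norm_num) (by norm_num)).mul_left _
  filter_upwards [ae_eventually_notMem_of_summable hsum hs] with ω hω
  have hlog : Tendsto (fun n => Nat.log 2 n + 1) atTop atTop :=
    (tendsto_add_atTop_nat 1).comp <| tendsto_atTop.2 fun b => by
      filter_upwards [eventually_ge_atTop (2 ^ b)] with n hn
      exact Nat.le_log_of_pow_le one_lt_two hn
  filter_upwards [hlog.eventually hω, eventually_ge_atTop 1] with n hn hn1
  -- Interpolation between dyadic sizes: the summands are nonnegative, so the sum grows with `n`,
  -- and `N ≤ 2 * n` costs the factor four.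
  set N : ℕ := 2 ^ (Nat.log 2 n + 1) with hN
  have hnN : n ≤ N := (Nat.lt_pow_succ_log_self one_lt_two n).le
  have hN2 : N ≤ 2 * n := by
    rw [hN, pow_succ, mul_comm]
    exact Nat.mul_le_mul_left 2 (Nat.pow_log_le_self 2 (by omega))
  have hTN : T N ω ≤ ε * (N : ℝ) ^ 2 := by
    simp only [s, Set.mem_ofPred_eq, not_le] at hn
    exact (le_abs_self _).trans (abs_lt_of_sq_lt_sq hn (by positivity)).le
  have nn : ∀ i j, 0 ≤ (if i = j then 0 else F (X i ω, X j ω)) := by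
    intro i j
    split_ifs
    · exact le_rfl
    · exact h0 _
  have hsub : Finset.range n ⊆ Finset.range N := Finset.range_subset_range.2 hnN
  calc ∑ i ∈ Finset.range n, ∑ j ∈ Finset.range n, (if i = j then 0 else F (X i ω, X j ω))
      ≤ ∑ i ∈ Finset.range N, ∑ j ∈ Finset.range N,
          (if i = j then 0 else F (X i ω, X j ω)) := by
        refine (Finset.sum_le_sum fun i _ =>
          Finset.sum_le_sum_of_subset_of_nonneg hsub fun j _ _ => nn i j).trans ?_
        exact Finset.sum_le_sum_of_subset_of_nonneg hsub fun i _ _ =>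
          Finset.sum_nonneg fun j _ => nn i j
    _ ≤ T N ω + ∑ i ∈ Finset.range N, ∑ j ∈ Finset.range N, μ := by
        simp only [T]
        rw [← Finset.sum_add_distrib]
        refine Finset.sum_le_sum fun i _ => ?_
        rw [← Finset.sum_add_distrib]
        refine Finset.sum_le_sum fun j _ => ?_
        split_ifs
        · simpa using μ0
        · simp [G]
    _ ≤ (μ + ε) * (N : ℝ) ^ 2 := by
        simp only [Finset.sum_const, Finset.card_range, nsmul_eq_mul]
        linarith
    _ ≤ (μ + ε) * (2 * (n : ℝ)) ^ 2 := by
        have : (N : ℝ) ≤ 2 * n := by exact_mod_cast hN2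
        gcongr
    _ = 4 * (μ + ε) * (n : ℝ) ^ 2 := by ring

end Sample

/-! ## Concentration of the edge noise -/

section Noise

variable {Ω : Type*} [MeasurableSpace Ω] {P : Measure Ω} [IsProbabilityMeasure P]

/-- Hoeffding's inequality for independent centred variables with values in `[-2, 2]`. -/
theorem measureReal_abs_sum_ge_le {ι : Type*} {N : ι → Ω → ℝ} (hi : iIndepFun N P)
    (hm : ∀ p, Measurable (N p)) (hb : ∀ p ω, |N p ω| ≤ 2) (h0 : ∀ p, ∫ ω, N p ω ∂P = 0)
    (s : Finset ι) {n : ℕ} (hs : s.card ≤ n ^ 2) {ε : ℝ} (hε : 0 < ε) :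
    P.real {ω | ε * (n : ℝ) ^ 2 ≤ |∑ p ∈ s, N p ω|} ≤
      2 * Real.exp (-(ε ^ 2 / 8 * (n : ℝ) ^ 2)) := by
  rcases Nat.eq_zero_or_pos n with rfl | hn
  · refine measureReal_le_one.trans ?_
    simp
  have hn' : (0 : ℝ) < n := by exact_mod_cast hn
  rcases s.eq_empty_or_nonempty with rfl | hne
  · have : {ω : Ω | ε * (n : ℝ) ^ 2 ≤ |∑ p ∈ (∅ : Finset ι), N p ω|} = ∅ := by
      ext ω
      simp only [Finset.sum_empty, abs_zero, Set.mem_ofPred_eq, Set.mem_empty_iff_false, iff_false,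
        not_le]
      positivity
    rw [this, measureReal_empty]
    positivity
  have hc : (0 : ℝ) < s.card := by exact_mod_cast hne.card_pos
  have one : ∀ {N : ι → Ω → ℝ}, iIndepFun N P → (∀ p, Measurable (N p)) →
      (∀ p ω, |N p ω| ≤ 2) → (∀ p, ∫ ω, N p ω ∂P = 0) →
      P.real {ω | ε * (n : ℝ) ^ 2 ≤ ∑ p ∈ s, N p ω} ≤
        Real.exp (-(ε ^ 2 / 8 * (n : ℝ) ^ 2)) := by
    intro N hi hm hb h0
    -- The parameter is the square of half the length of `[-2, 2]`. The resulting exponent `ε² n⁴ /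
    -- (2 · 4 · card s)` is at least `ε² n² / 8` because `card s ≤ n ^ 2`.
    have hsub : ∀ p ∈ s, HasSubgaussianMGF (N p) 4 P := by
      intro p _
      have := hasSubgaussianMGF_of_mem_Icc_of_integral_eq_zero (a := -2) (b := 2)
        (hm p).aemeasurable (ae_of_all P fun ω => abs_le.1 (hb p ω)) (h0 p)
      convert this using 1
      ext
      norm_num
    refine (HasSubgaussianMGF.measure_sum_ge_le_of_iIndepFun hi hsub (by positivity)).trans ?_
    rw [Real.exp_le_exp, Finset.sum_const, nsmul_eq_mul]
    push_cast
    have hs' : (s.card : ℝ) ≤ (n : ℝ) ^ 2 := by exact_mod_cast hs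
    rw [neg_div, neg_le_neg_iff, le_div_iff₀ (by positivity)]
    have : ε ^ 2 * (n : ℝ) ^ 2 * s.card ≤ ε ^ 2 * (n : ℝ) ^ 2 * (n : ℝ) ^ 2 := by gcongr
    linarith
  have a := one hi hm hb h0
  have b := one (N := fun p ω => -N p ω) (hi.comp (fun _ => Neg.neg) fun _ => measurable_neg)
    (fun p => (hm p).neg) (fun p ω => by simpa using hb p ω) (fun p => by
      rw [integral_neg, h0, neg_zero])
  calc P.real {ω | ε * (n : ℝ) ^ 2 ≤ |∑ p ∈ s, N p ω|}
      ≤ P.real ({ω | ε * (n : ℝ) ^ 2 ≤ ∑ p ∈ s, N p ω} ∪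
          {ω | ε * (n : ℝ) ^ 2 ≤ ∑ p ∈ s, -N p ω}) := by
        refine measureReal_mono fun ω hω => ?_
        simpa only [Set.mem_union, Set.mem_ofPred_eq, Finset.sum_neg_distrib, le_abs] using hω
    _ ≤ _ := (measureReal_union_le _ _).trans (by linarith)

/-- Completing the square gives `(log 4 + 1) n - c n² ≤ K`, so the terms are dominated by a multiple
of `exp (-n)`. -/
theorem summable_four_pow_mul_exp_neg_sq {c : ℝ} (hc : 0 < c) :
    Summable fun n : ℕ => (4 : ℝ) ^ n * (2 * Real.exp (-(c * (n : ℝ) ^ 2))) := by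
  set K : ℝ := (Real.log 4 + 1) ^ 2 / (4 * c)
  refine Summable.of_nonneg_of_le (fun n => by positivity) (fun n => ?_)
    (Real.summable_exp_neg_nat.mul_left (2 * Real.exp K))
  have e : (4 : ℝ) ^ n = Real.exp (n * Real.log 4) := by
    rw [Real.exp_nat_mul, Real.exp_log (by norm_num)]
  rw [e, mul_left_comm, mul_assoc, ← Real.exp_add, ← Real.exp_add]
  refine mul_le_mul_of_nonneg_left (Real.exp_le_exp.2 ?_) zero_le_two
  have h := sq_nonneg ((Real.log 4 + 1) - 2 * c * n)
  have : ((Real.log 4 + 1) * n - c * (n : ℝ) ^ 2) ≤ K := by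
    rw [le_div_iff₀ (by positivity)]
    nlinarith
  linarith

/-- The pairs `i < j` with `i ∈ S` and `j ∈ T`. -/
def pairsIn (S T : Finset ℕ) : Finset Pair :=
  (S ×ˢ T).subtype fun q => q.1 < q.2

theorem card_pairsIn_le {n : ℕ} {S T : Finset ℕ} (hS : S ⊆ Finset.range n)
    (hT : T ⊆ Finset.range n) : (pairsIn S T).card ≤ n ^ 2 := by
  have h1 := Finset.card_le_card hS
  have h2 := Finset.card_le_card hT
  rw [Finset.card_range] at h1 h2
  rw [pairsIn, Finset.card_subtype, sq]
  refine (Finset.card_filter_le _ _).trans ?_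
  rw [Finset.card_product]
  exact Nat.mul_le_mul h1 h2

theorem sum_pairsIn (S T : Finset ℕ) (N : ℕ → ℕ → ℝ) :
    ∑ p ∈ pairsIn S T, N p.1.1 p.1.2 = ∑ i ∈ S, ∑ j ∈ T, if i < j then N i j else 0 := by
  rw [pairsIn, Finset.sum_subtype_eq_sum_filter (f := fun q : ℕ × ℕ => N q.1 q.2),
    Finset.sum_filter, Finset.sum_product]

variable {X : ℕ → Ω → I} {V : Pair → Ω → I} {h : I → I → I → ℝ} {g : I → I → ℝ}

/-- Vertex and edge families are independent, so their joint law is a product. With the vertices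
frozen, the summands are independent, and centred by the choice of `g`; Hoeffding's bound does not
depend on the frozen values and is integrated over them. -/
theorem measureReal_noise_ge_le (hX : ∀ i, Measurable (X i)) (hV : IsUniformSample P V)
    (hXV : (fun ω i => X i ω) ⟂ᵢ[P] (fun ω p => V p ω))
    (hh : Measurable fun q : I × I × I => h q.1 q.2.1 q.2.2) (hb : ∀ x y v, |h x y v| ≤ 1)
    (hg : Measurable fun p : I × I => g p.1 p.2) (hgh : ∀ x y, g x y = ∫ v, h x y v)
    (s : Finset Pair) {n : ℕ} (hs : s.card ≤ n ^ 2) {ε : ℝ} (hε : 0 < ε) :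
    P.real {ω | ε * (n : ℝ) ^ 2 ≤ |∑ p ∈ s, (h (X p.1.1 ω) (X p.1.2 ω) (V p ω)
      - g (X p.1.1 ω) (X p.1.2 ω))|} ≤ 2 * Real.exp (-(ε ^ 2 / 8 * (n : ℝ) ^ 2)) := by
  have mX : Measurable fun ω i => X i ω := measurable_pi_lambda _ hX
  have mV : Measurable fun ω p => V p ω := measurable_pi_lambda _ hV.measurable
  have bg : ∀ x y, |g x y| ≤ 1 := by
    intro x y
    rw [hgh, ← Real.norm_eq_abs]
    simpa using norm_integral_le_of_norm_le_const (μ := (volume : Measure I))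
      (f := h x y) (C := 1) (ae_of_all _ fun v => hb x y v)
  let E : Set ((ℕ → I) × (Pair → I)) := {z | ε * (n : ℝ) ^ 2 ≤
    |∑ p ∈ s, (h (z.1 p.1.1) (z.1 p.1.2) (z.2 p) - g (z.1 p.1.1) (z.1 p.1.2))|}
  have mN : ∀ p : Pair, Measurable fun z : (ℕ → I) × (Pair → I) =>
      h (z.1 p.1.1) (z.1 p.1.2) (z.2 p) - g (z.1 p.1.1) (z.1 p.1.2) := by
    intro p
    refine Measurable.sub ?_ ?_
    · exact hh.comp (f := fun z : (ℕ → I) × (Pair → I) => (z.1 p.1.1, z.1 p.1.2, z.2 p))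
        (by fun_prop)
    · exact hg.comp (f := fun z : (ℕ → I) × (Pair → I) => (z.1 p.1.1, z.1 p.1.2)) (by fun_prop)
  have mE : MeasurableSet E :=
    measurableSet_le measurable_const
      (continuous_abs.measurable.comp (Finset.measurable_sum _ fun p _ => mN p))
  have fibre : ∀ x : ℕ → I, P.map (fun ω p => V p ω) (Prod.mk x ⁻¹' E) ≤
      ENNReal.ofReal (2 * Real.exp (-(ε ^ 2 / 8 * (n : ℝ) ^ 2))) := by
    intro x
    rw [Measure.map_apply mV (measurable_prodMk_left mE)]
    rw [← ENNReal.ofReal_toReal (measure_ne_top P _)]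
    refine ENNReal.ofReal_le_ofReal ?_
    have mN' : ∀ p : Pair, Measurable fun v : I => h (x p.1.1) (x p.1.2) v - g (x p.1.1) (x p.1.2) :=
      fun p => (hh.comp (f := fun v : I => (x p.1.1, x p.1.2, v)) (by fun_prop)).sub
        measurable_const
    refine measureReal_abs_sum_ge_le
      (N := fun p ω => h (x p.1.1) (x p.1.2) (V p ω) - g (x p.1.1) (x p.1.2))
      (hV.indep.comp _ mN') (fun p => (mN' p).comp (hV.measurable p))
      (fun p ω => (abs_sub _ _).trans ?_) (fun p => ?_) s hs hε
    · linarith [hb (x p.1.1) (x p.1.2) (V p ω), bg (x p.1.1) (x p.1.2)]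
    · have mp := hV.measurePreserving p
      have : ∫ ω, (h (x p.1.1) (x p.1.2) (V p ω) - g (x p.1.1) (x p.1.2)) ∂P =
          ∫ v, (h (x p.1.1) (x p.1.2) v - g (x p.1.1) (x p.1.2)) := by
        rw [← mp.map_eq, integral_map mp.measurable.aemeasurable (mN' p).aestronglyMeasurable]
      have mh : Measurable fun v => h (x p.1.1) (x p.1.2) v :=
        hh.comp (f := fun v : I => (x p.1.1, x p.1.2, v)) (by fun_prop)
      have hi : Integrable fun v => h (x p.1.1) (x p.1.2) v :=
        Integrable.of_bound mh.aestronglyMeasurable 1 (ae_of_all _ fun v => hb _ _ v)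
      rw [this, integral_sub hi (integrable_const _), ← hgh]
      simp
  have joint := (indepFun_iff_map_prod_eq_prod_map_map mX.aemeasurable mV.aemeasurable).1 hXV
  have e : P {ω | ε * (n : ℝ) ^ 2 ≤ |∑ p ∈ s, (h (X p.1.1 ω) (X p.1.2 ω) (V p ω)
      - g (X p.1.1 ω) (X p.1.2 ω))|} =
      ∫⁻ x, P.map (fun ω p => V p ω) (Prod.mk x ⁻¹' E) ∂(P.map fun ω i => X i ω) := by
    rw [← Measure.prod_apply mE, ← joint, Measure.map_apply (mX.prodMk mV) mE]
    rfl
  have := Measure.isProbabilityMeasure_map (μ := P) mX.aemeasurable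
  rw [Measure.real, e]
  refine ENNReal.toReal_le_of_le_ofReal (by positivity) ?_
  refine (lintegral_mono fibre).trans ?_
  simp

/-- The deviation of the edge variables from their conditional means vanishes in the cut norm. -/
theorem ae_eventually_noise_lt (hX : ∀ i, Measurable (X i)) (hV : IsUniformSample P V)
    (hXV : (fun ω i => X i ω) ⟂ᵢ[P] (fun ω p => V p ω))
    (hh : Measurable fun q : I × I × I => h q.1 q.2.1 q.2.2) (hb : ∀ x y v, |h x y v| ≤ 1)
    (hg : Measurable fun p : I × I => g p.1 p.2) (hgh : ∀ x y, g x y = ∫ v, h x y v)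
    {ε : ℝ} (hε : 0 < ε) :
    ∀ᵐ ω ∂P, ∀ᶠ n : ℕ in atTop, ∀ S ⊆ Finset.range n, ∀ T ⊆ Finset.range n,
      |∑ p ∈ pairsIn S T, (h (X p.1.1 ω) (X p.1.2 ω) (V p ω)
        - g (X p.1.1 ω) (X p.1.2 ω))| < ε * (n : ℝ) ^ 2 := by
  let bad : Finset ℕ × Finset ℕ → ℕ → Set Ω := fun z n => {ω | ε * (n : ℝ) ^ 2 ≤
    |∑ p ∈ pairsIn z.1 z.2, (h (X p.1.1 ω) (X p.1.2 ω) (V p ω) - g (X p.1.1 ω) (X p.1.2 ω))|}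
  -- Union bound over the `2 ^ n * 2 ^ n` choices of `(S, T)`.
  have hsmall : ∀ n : ℕ, P.real (⋃ z ∈ (Finset.range n).powerset ×ˢ (Finset.range n).powerset,
      bad z n) ≤ (4 : ℝ) ^ n * (2 * Real.exp (-(ε ^ 2 / 8 * (n : ℝ) ^ 2))) := by
    intro n
    refine (measureReal_biUnion_finset_le _ _).trans ?_
    refine (Finset.sum_le_sum fun z hz => measureReal_noise_ge_le hX hV hXV hh hb hg hgh
      (pairsIn z.1 z.2) (n := n) ?_ hε).trans (le_of_eq ?_)
    · rw [Finset.mem_product, Finset.mem_powerset, Finset.mem_powerset] at hz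
      exact card_pairsIn_le hz.1 hz.2
    · rw [Finset.sum_const, Finset.card_product, Finset.card_powerset, Finset.card_range,
        nsmul_eq_mul]
      push_cast
      rw [← mul_pow]
      norm_num
  filter_upwards [ae_eventually_notMem_of_summable
    (summable_four_pow_mul_exp_neg_sq (by positivity : 0 < ε ^ 2 / 8)) hsmall] with ω hω
  filter_upwards [hω] with n hn S hS T hT
  by_contra hlt
  refine hn (Set.mem_biUnion (x := (S, T)) ?_ (not_lt.1 hlt))
  exact Finset.mem_coe.2 (Finset.mem_product.2
    ⟨Finset.mem_powerset.2 hS, Finset.mem_powerset.2 hT⟩)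

end Noise

/-! ## Convergence of sampled graphons -/

theorem matrixEntry_of_lt (a : Pair → Set.Icc (-1 : ℝ) 1) {i j : ℕ} (h : i < j) :
    matrixEntry a i j = a ⟨(i, j), h⟩ := by
  have : mkPair i j h.ne = ⟨(i, j), h⟩ := by
    apply Subtype.ext
    simp [mkPair, min_eq_left h.le, max_eq_right h.le]
  rw [matrixEntry, dif_pos h.ne, this]

theorem matrixEntry_comm (a : Pair → Set.Icc (-1 : ℝ) 1) (i j : ℕ) :
    matrixEntry a i j = matrixEntry a j i := by
  by_cases h : i = j
  · rw [h]
  · have : mkPair i j h = mkPair j i (Ne.symm h) := by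
      apply Subtype.ext
      simp [mkPair, min_comm, max_comm]
    rw [matrixEntry, matrixEntry, dif_pos h, dif_pos (Ne.symm h), this]

/-- Sums over a rectangle of the off-diagonal deviations split into two sums over pairs. -/
theorem sum_offDiag_eq (a : Pair → Set.Icc (-1 : ℝ) 1) {w : ℕ → ℕ → ℝ}
    (hw : ∀ i j, i ≠ j → w i j = w j i) (S T : Finset ℕ) :
    ∑ i ∈ S, ∑ j ∈ T, (if i = j then 0 else matrixEntry a i j - w i j) =
      ∑ p ∈ pairsIn S T, ((a p : ℝ) - w p.1.1 p.1.2)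
        + ∑ p ∈ pairsIn T S, ((a p : ℝ) - w p.1.1 p.1.2) := by
  have e : ∀ S T : Finset ℕ, ∑ p ∈ pairsIn S T, ((a p : ℝ) - w p.1.1 p.1.2) =
      ∑ i ∈ S, ∑ j ∈ T, if i < j then matrixEntry a i j - w i j else 0 := by
    intro S T
    rw [← sum_pairsIn]
    exact Finset.sum_congr rfl fun p _ => by rw [matrixEntry_of_lt a p.2]
  rw [e, e, Finset.sum_comm (s := T), ← Finset.sum_add_distrib]
  refine Finset.sum_congr rfl fun i _ => ?_
  rw [← Finset.sum_add_distrib]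
  refine Finset.sum_congr rfl fun j _ => ?_
  rcases lt_trichotomy i j with h | h | h
  · simp [h, h.ne, h.not_gt]
  · simp [h]
  · simp [h, h.ne', h.not_gt, matrixEntry_comm a i j, hw i j h.ne']

section Convergence

variable {Ω : Type*} [MeasurableSpace Ω] {P : Measure Ω} [IsProbabilityMeasure P]
  {X : ℕ → Ω → I} {V : Pair → Ω → I}

/-- Each `ε` brings its own grid and its own null set, so the tolerance runs through the sequence `1
/ (q + 1)` only. -/
theorem ae_tendsto_cutDist (hX : IsUniformSample P X) (hV : IsUniformSample P V)
    (hXV : (fun ω i => X i ω) ⟂ᵢ[P] (fun ω p => V p ω)) {h : I → I → I → Set.Icc (-1 : ℝ) 1}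
    (hh : Measurable fun q : I × I × I => h q.1 q.2.1 q.2.2) (W : SymmKernel)
    (hW : ∀ x y, W.1 x y = ∫ v, (h x y v : ℝ)) :
    ∀ᵐ ω ∂P, Tendsto (fun n : ℕ => cutDist ⟨stepFun n fun p => h (X p.1.1 ω) (X p.1.2 ω) (V p ω),
      isKernel_stepFun n _⟩ W) atTop (𝓝 0) := by
  -- `W` is symmetric only almost everywhere, but `(X i, X j)` is uniform on the square for `i ≠ j`,
  -- so the sampled matrix is almost surely symmetric off the diagonal.
  have hsymm : ∀ᵐ ω ∂P, ∀ i j, i ≠ j → W.1 (X i ω) (X j ω) = W.1 (X j ω) (X i ω) := by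
    refine ae_all_iff.2 fun i => ae_all_iff.2 fun j => ?_
    by_cases hij : i = j
    · simp [hij]
    · filter_upwards [(hX.measurePreserving_pair hij).quasiMeasurePreserving.ae W.2.symm]
        with ω hω _
      exact hω
  have key : ∀ q : ℕ, ∀ᵐ ω ∂P, ∀ᶠ n : ℕ in atTop,
      cutDist ⟨stepFun n fun p => h (X p.1.1 ω) (X p.1.2 ω) (V p ω), isKernel_stepFun n _⟩ W
        ≤ 13 * (1 / ((q : ℝ) + 1)) := by
    intro q
    set ε : ℝ := 1 / ((q : ℝ) + 1) with hε_def
    have hε : 0 < ε := by positivity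
    have iW := integrable_of_bdd W.2.measurable W.abs_le
    obtain ⟨m, c, C, hm, hc, hi⟩ := exists_blockFun_integral_le iW hε
    have hC : 0 ≤ C := (abs_nonneg _).trans (hc 0 0)
    have a₁ := ae_eventually_noise_lt (P := P) hX.measurable hV hXV
      (h := fun x y v => (h x y v : ℝ)) (g := W.1) (measurable_subtype_coe.comp hh)
      (fun x y v => abs_le.2 (h x y v).2) W.2.measurable hW hε
    have a₂ := ae_eventually_sum_pairs_le hX
      (F := fun p => |W.1 p.1 p.2 - blockFun m c p.1 p.2|) (C := 1 + C)
      (continuous_abs.measurable.comp (W.2.measurable.sub (measurable_blockFun m c)))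
      (fun p => abs_nonneg _)
      (fun p => (abs_sub _ _).trans (add_le_add (W.abs_le _ _) (hc _ _))) hε
    have a₃ : ∀ᵐ ω ∂P, ∀ k ∈ Finset.range m, Tendsto (fun n : ℕ =>
        (((Finset.range n).filter fun i => blockIndex m (X i ω) = k).card : ℝ) / n)
          atTop (𝓝 (1 / m)) := by
      refine (Finset.eventually_all _).2 fun k hk => ?_
      exact ae_tendsto_block_frequency hX (Finset.mem_range.1 hk)
    filter_upwards [a₁, a₂, a₃, hsymm] with ω h₁ h₂ h₃ hs
    have hdisc : Tendsto (fun n : ℕ => 4 * C * ∑ k ∈ Finset.range m,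
        |(((Finset.range n).filter fun i => blockIndex m (X i ω) = k).card : ℝ) / n - 1 / m|)
          atTop (𝓝 0) := by
      have : Tendsto (fun n : ℕ => ∑ k ∈ Finset.range m,
        |(((Finset.range n).filter fun i => blockIndex m (X i ω) = k).card : ℝ) / n - 1 / m|)
          atTop (𝓝 (∑ k ∈ Finset.range m, |(1 : ℝ) / m - 1 / m|)) :=
        tendsto_finsetSum _ fun k hk => ((h₃ k hk).sub_const _).abs
      simpa using this.const_mul (4 * C)
    have hdiag : Tendsto (fun n : ℕ => C / (n : ℝ)) atTop (𝓝 0) :=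
      tendsto_const_div_atTop_nhds_zero_nat C
    filter_upwards [h₁, h₂, hdisc.eventually_le_const hε, hdiag.eventually_le_const hε,
      eventually_gt_atTop 0] with n e₁ e₂ e₃ e₄ hn
    -- The constant `13` is `2` for the noise above and below the diagonal, `8 = 4 (1 + 1)` for the
    -- sampled approximation error, and `1` each for the diagonal, the label discrepancy and the
    -- `L¹` error.
    have := cutDist_stepFun_le W (fun p => h (X p.1.1 ω) (X p.1.2 ω) (V p ω)) (fun i => X i ω)
      hn hm hc (ε₁ := 2 * ε) (ε₂ := 8 * ε) (fun S hS T hT => ?_) ?_ hi le_rfl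
    · linarith
    · rw [sum_offDiag_eq _ (w := fun i j => W.1 (X i ω) (X j ω)) hs]
      refine (abs_add_le _ _).trans ?_
      have s₁ := e₁ S hS T hT
      have s₂ := e₁ T hT S hS
      linarith
    · refine e₂.trans ?_
      have : 0 ≤ (n : ℝ) ^ 2 := by positivity
      nlinarith
  filter_upwards [ae_all_iff.2 key] with ω hω
  refine tendsto_order.2 ⟨fun b hb => Eventually.of_forall fun n =>
    hb.trans_le (cutDist_nonneg _ _), fun b hb => ?_⟩
  have hlim : Tendsto (fun q : ℕ => 13 * (1 / ((q : ℝ) + 1))) atTop (𝓝 0) := by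
    simpa using tendsto_one_div_add_atTop_nhds_zero_nat.const_mul (13 : ℝ)
  obtain ⟨q, hq⟩ := (hlim.eventually_lt_const hb).exists
  exact (hω q).mono fun n hn => hn.trans_lt hq

end Convergence

/-! ## Truncations depend continuously on the array -/

theorem continuous_matrixEntry (i j : ℕ) :
    Continuous fun a : Pair → Set.Icc (-1 : ℝ) 1 => matrixEntry a i j := by
  by_cases h : i = j
  · simp only [matrixEntry, h, ne_eq, not_true_eq_false, dite_false]
    exact continuous_const
  · simp only [matrixEntry, ne_eq, h, not_false_eq_true, dite_true]
    fun_prop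

theorem cutDist_stepFun_stepFun_le {n : ℕ} (hn : 0 < n) (a b : Pair → Set.Icc (-1 : ℝ) 1) :
    cutDist ⟨stepFun n a, isKernel_stepFun n a⟩ ⟨stepFun n b, isKernel_stepFun n b⟩ ≤
      (∑ i ∈ Finset.range n, ∑ j ∈ Finset.range n, |matrixEntry a i j - matrixEntry b i j|)
        / (n : ℝ) ^ 2 := by
  refine (cutDist_le _ _ (MeasurePreserving.id _) (MeasurePreserving.id _)).trans ?_
  rw [← integral_blockFun hn]
  exact cutNorm_le_integral (F := fun x y => stepFun n a x y - stepFun n b x y) (C := 2)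
    ((isKernel_stepFun n a).measurable.sub (isKernel_stepFun n b).measurable)
    (fun x y => abs_sub_le_two ⟨_, isKernel_stepFun n a⟩ ⟨_, isKernel_stepFun n b⟩ _ _ _ _)

theorem continuous_truncGraphon (n : ℕ) : Continuous (truncGraphon n) := by
  rcases Nat.eq_zero_or_pos n with rfl | hn
  -- For `n = 0` the cap `n - 1` is `0`, so every point has index `0` and only the zero diagonal is
  -- read.
  · have : truncGraphon 0 = fun _ => truncGraphon 0 (fun _ => ⟨0, by simp⟩) := by
      funext a
      refine congrArg SymmKernel.toGraphon (Subtype.ext ?_)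
      funext x y
      simp [stepFun, blockIndex, matrixEntry]
    rw [this]
    exact continuous_const
  · refine continuous_iff_continuousAt.2 fun a => ?_
    rw [ContinuousAt, tendsto_iff_dist_tendsto_zero]
    have hc : Continuous fun b : Pair → Set.Icc (-1 : ℝ) 1 =>
        (∑ i ∈ Finset.range n, ∑ j ∈ Finset.range n, |matrixEntry b i j - matrixEntry a i j|)
          / (n : ℝ) ^ 2 := by
      refine Continuous.div_const (continuous_finsetSum _ fun i _ =>
        continuous_finsetSum _ fun j _ => ?_) _
      exact ((continuous_matrixEntry i j).sub continuous_const).abs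
    have h0 := hc.tendsto a
    simp only [sub_self, abs_zero, Finset.sum_const_zero, zero_div] at h0
    exact squeeze_zero (fun _ => dist_nonneg) (fun b => cutDist_stepFun_stepFun_le hn b a) h0

/-! ## Independence of the seeds -/

section Seeds

theorem measurable_iSup_comap {Ω : Type*} {U : Seed → Ω → I} {A : Set Seed} {s : Seed} (hs : s ∈ A) :
    Measurable[⨆ s ∈ A, MeasurableSpace.comap (U s) inferInstance] (U s) :=
  Measurable.of_comap_le (le_iSup₂_of_le s hs le_rfl)

variable {Ω : Type*} [MeasurableSpace Ω] {P : Measure Ω} {U : Seed → Ω → I}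

theorem IsIIDUniform.isUniformSample (hU : IsIIDUniform P U) {ι : Type*} {e : ι → Seed}
    (he : Function.Injective e) : IsUniformSample P fun i => U (e i) :=
  ⟨fun _ => hU.measurable _, fun _ => hU.uniform _, hU.indep.precomp he⟩

theorem IsIIDUniform.indepFun_of_disjoint (hU : IsIIDUniform P U) {A B : Set Seed}
    (hAB : Disjoint A B) {α β : Type*} [MeasurableSpace α] [MeasurableSpace β] {f : Ω → α}
    {g : Ω → β}
    (hf : Measurable[⨆ s ∈ A, MeasurableSpace.comap (U s) inferInstance] f)
    (hg : Measurable[⨆ s ∈ B, MeasurableSpace.comap (U s) inferInstance] g) : f ⟂ᵢ[P] g := by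
  have h := indep_iSup_of_disjoint (fun s => (hU.measurable s).comap_le) hU.indep.iIndep hAB
  rw [IndepFun_iff_Indep]
  exact indep_of_indep_of_le_left (indep_of_indep_of_le_right h hg.comap_le) hf.comap_le

/-- The vertex and edge variables. -/
def vertexEdge (U : Seed → Ω → I) (ω : Ω) : (ℕ → I) × (Pair → I) :=
  (fun i => U (.vertex i) ω, fun p => U (.edge p) ω)

theorem IsIIDUniform.measurable_vertexEdge (hU : IsIIDUniform P U) :
    Measurable (vertexEdge U) :=
  (measurable_pi_lambda _ fun _ => hU.measurable _).prodMk
    (measurable_pi_lambda _ fun _ => hU.measurable _)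

theorem IsIIDUniform.indepFun_vertex_edge (hU : IsIIDUniform P U) :
    (fun ω i => U (.vertex i) ω) ⟂ᵢ[P] (fun ω p => U (.edge p) ω) := by
  refine hU.indepFun_of_disjoint (A := Set.range Seed.vertex) (B := Set.range Seed.edge) ?_ ?_ ?_
  · rw [Set.disjoint_left]
    rintro _ ⟨i, rfl⟩ ⟨p, hp⟩
    cases hp
  · exact @measurable_pi_lambda _ _ _ (_) _ _ fun i => measurable_iSup_comap ⟨i, rfl⟩
  · exact @measurable_pi_lambda _ _ _ (_) _ _ fun p => measurable_iSup_comap ⟨p, rfl⟩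

theorem IsIIDUniform.indepFun_root_vertexEdge (hU : IsIIDUniform P U) :
    U .root ⟂ᵢ[P] vertexEdge U := by
  refine hU.indepFun_of_disjoint (A := {.root}) (B := {.root}ᶜ) disjoint_compl_right ?_ ?_
  · exact measurable_iSup_comap rfl
  · refine @Measurable.prodMk _ _ _ _ _ (_) _ _ ?_ ?_
    · exact @measurable_pi_lambda _ _ _ (_) _ _ fun i =>
        measurable_iSup_comap (s := .vertex i) (by simp)
    · exact @measurable_pi_lambda _ _ _ (_) _ _ fun p =>
        measurable_iSup_comap (s := .edge p) (by simp)

variable [IsProbabilityMeasure P]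

theorem IsIIDUniform.map_root_vertexEdge (hU : IsIIDUniform P U) :
    P.map (fun ω => (U .root ω, vertexEdge U ω)) =
      (volume : Measure I).prod (P.map (vertexEdge U)) := by
  rw [(indepFun_iff_map_prod_eq_prod_map_map (hU.measurable _).aemeasurable
    hU.measurable_vertexEdge.aemeasurable).1 hU.indepFun_root_vertexEdge, hU.uniform]

/-- This turns almost sure identities between values of `f` at the seeds into almost everywhere
identities on the cube. -/
theorem IsIIDUniform.measurePreserving_root_pair_edge (hU : IsIIDUniform P U) (p : Pair) :
    MeasurePreserving (fun ω => (U .root ω, (U (.vertex p.1.1) ω, U (.vertex p.1.2) ω),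
      U (.edge p) ω)) P volume := by
  have mp := (hU.isUniformSample (e := Seed.vertex) fun _ _ h => by
    cases h; rfl).measurePreserving_pair p.2.ne
  have m : Measurable fun z : (ℕ → I) × (Pair → I) => ((z.1 p.1.1, z.1 p.1.2), z.2 p) := by
    fun_prop
  have mve := hU.measurable_vertexEdge
  have e₁ : P.map (fun ω => ((U (.vertex p.1.1) ω, U (.vertex p.1.2) ω), U (.edge p) ω)) =
      volume := by
    have m₁ : Measurable fun x : ℕ → I => (x p.1.1, x p.1.2) := by fun_prop
    have m₂ : Measurable fun v : Pair → I => v p := measurable_pi_apply p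
    have := hU.indepFun_vertex_edge.comp m₁ m₂
    have := (indepFun_iff_map_prod_eq_prod_map_map mp.measurable.aemeasurable
      (hU.measurable _).aemeasurable).1 this
    rw [mp.map_eq] at this
    exact this.trans (by rw [hU.uniform]; rfl)
  refine ⟨(hU.measurable _).prodMk (m.comp mve), ?_⟩
  have := hU.indepFun_root_vertexEdge.comp measurable_id m
  have := (indepFun_iff_map_prod_eq_prod_map_map (hU.measurable _).aemeasurable
    (m.comp mve).aemeasurable).1 this
  refine this.trans ?_
  rw [hU.uniform]
  exact congrArg _ e₁

end Seeds

/-! ## The random graphon of a representation -/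

section Representation

variable {f : I → I → I → I → Set.Icc (-1 : ℝ) 1}

theorem measurable_meanKernel
    (hf : Measurable fun q : I × I × I × I => f q.1 q.2.1 q.2.2.1 q.2.2.2) :
    Measurable fun q : I × I × I => meanKernel f q.1 q.2.1 q.2.2 := by
  have : Measurable fun z : (I × I × I) × I => (f z.1.1 z.1.2.1 z.1.2.2 z.2 : ℝ) :=
    measurable_subtype_coe.comp (hf.comp
      (f := fun z : (I × I × I) × I => (z.1.1, z.1.2.1, z.1.2.2, z.2)) (by fun_prop))
  exact this.stronglyMeasurable.integral_prod_right.measurable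

theorem meanKernel_mem_Icc (f : I → I → I → I → Set.Icc (-1 : ℝ) 1) (u x y : I) :
    meanKernel f u x y ∈ Set.Icc (-1 : ℝ) 1 := by
  refine abs_le.1 ?_
  have := norm_integral_le_of_norm_le_const (μ := (volume : Measure I))
    (f := fun v => (f u x y v : ℝ)) (C := 1) (ae_of_all _ fun v => abs_le.2 (f u x y v).2)
  simpa [meanKernel] using this

theorem isKernel_meanKernel_iff
    (hf : Measurable fun q : I × I × I × I => f q.1 q.2.1 q.2.2.1 q.2.2.2) (u : I) :
    IsKernel (meanKernel f u) ↔
      ∀ᵐ p : I × I, meanKernel f u p.1 p.2 = meanKernel f u p.2 p.1 := by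
  refine ⟨fun h => h.symm, fun h => ⟨⟨?_, ⟨1, fun x y => abs_le.2 (meanKernel_mem_Icc f u x y)⟩, h⟩,
    meanKernel_mem_Icc f u⟩⟩
  exact (measurable_meanKernel hf).comp (f := fun p : I × I => (u, p.1, p.2)) (by fun_prop)

/-- Only symmetry can fail, and it holds when the section at `u` of the asymmetry set is null; the
measure of a section is measurable in `u`. -/
theorem measurableSet_isKernel
    (hf : Measurable fun q : I × I × I × I => f q.1 q.2.1 q.2.2.1 q.2.2.2) :
    MeasurableSet {u | IsKernel (meanKernel f u)} := by
  have hg := measurable_meanKernel hf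
  have hm : MeasurableSet {z : I × I × I | ¬meanKernel f z.1 z.2.1 z.2.2 =
      meanKernel f z.1 z.2.2 z.2.1} :=
    (measurableSet_eq_fun hg (hg.comp (f := fun z : I × I × I => (z.1, z.2.2, z.2.1))
      (by fun_prop))).compl
  have : {u | IsKernel (meanKernel f u)} = {u | volume (Prod.mk u ⁻¹' {z : I × I × I |
      ¬meanKernel f z.1 z.2.1 z.2.2 = meanKernel f z.1 z.2.2 z.2.1}) = 0} := by
    ext u
    exact isKernel_meanKernel_iff hf u
  rw [this]
  exact measurable_measure_prodMk_left hm (measurableSet_singleton 0)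

theorem graphonOf_of_not {W : I → I → ℝ} (h : ¬IsKernel W) :
    graphonOf W = SymmKernel.toGraphon ⟨_, isKernel_zero⟩ := dif_neg h

/-- The array with entries `f(u, x_i, x_j, v_{i,j})`. -/
def seedArray (f : I → I → I → I → Set.Icc (-1 : ℝ) 1) (u : I) (z : (ℕ → I) × (Pair → I))
    (p : Pair) : Set.Icc (-1 : ℝ) 1 :=
  f u (z.1 p.1.1) (z.1 p.1.2) (z.2 p)

theorem measurable_seedArray
    (hf : Measurable fun q : I × I × I × I => f q.1 q.2.1 q.2.2.1 q.2.2.2) :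
    Measurable fun q : I × (ℕ → I) × (Pair → I) => seedArray f q.1 q.2 :=
  measurable_pi_lambda _ fun p => hf.comp (f := fun q : I × (ℕ → I) × (Pair → I) =>
    (q.1, q.2.1 p.1.1, q.2.1 p.1.2, q.2.2 p)) (by fun_prop)

variable {Ω : Type*} [MeasurableSpace Ω] {P : Measure Ω} [IsProbabilityMeasure P]
  {U : Seed → Ω → I}

theorem ae_tendsto_dist_seedArray
    (hf : Measurable fun q : I × I × I × I => f q.1 q.2.1 q.2.2.1 q.2.2.2)
    (hU : IsIIDUniform P U) {u : I} (hu : IsKernel (meanKernel f u)) :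
    ∀ᵐ ω ∂P, Tendsto (fun n : ℕ => dist (truncGraphon n (seedArray f u (vertexEdge U ω)))
      (graphonOf (meanKernel f u))) atTop (𝓝 0) := by
  rw [graphonOf, dif_pos hu]
  exact ae_tendsto_cutDist
    (hU.isUniformSample (e := Seed.vertex) fun _ _ h => by cases h; rfl)
    (hU.isUniformSample (e := Seed.edge) fun _ _ h => by cases h; rfl)
    hU.indepFun_vertex_edge (h := f u)
    (hf.comp (f := fun q : I × I × I => (u, q.1, q.2.1, q.2.2)) (by fun_prop))
    ⟨meanKernel f u, hu⟩ (fun _ _ => rfl)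

/-- Where `g_u` is a kernel, dominated convergence makes `F [g_u]` the limit of the expectations `J
n u` at sampled truncations, which are measurable in `u` by Fubini. Elsewhere the value is constant.
-/
theorem measurable_comp_graphonOf_meanKernel
    (hf : Measurable fun q : I × I × I × I => f q.1 q.2.1 q.2.2.1 q.2.2.2)
    (hU : IsIIDUniform P U) {F : Graphon → ℝ} (hF : Continuous F) (hb : ∀ x, |F x| ≤ 1) :
    Measurable fun u => F (graphonOf (meanKernel f u)) := by
  classical
  have mve := hU.measurable_vertexEdge
  have := Measure.isProbabilityMeasure_map (μ := P) mve.aemeasurable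
  have mA : ∀ n, Measurable fun q : I × (ℕ → I) × (Pair → I) =>
      F (truncGraphon n (seedArray f q.1 q.2)) := fun n =>
    ((hF.comp (continuous_truncGraphon n)).measurable).comp (measurable_seedArray hf)
  let K : Set I := {u | IsKernel (meanKernel f u)}
  let J : ℕ → I → ℝ := fun n u =>
    ∫ z, F (truncGraphon n (seedArray f u z)) ∂(P.map (vertexEdge U))
  have mJ : ∀ n, Measurable (J n) := fun n =>
    (mA n).stronglyMeasurable.integral_prod_right.measurable
  refine measurable_of_tendsto_metrizable (f := fun n => K.piecewise (J n)
    (fun _ => F (SymmKernel.toGraphon ⟨_, isKernel_zero⟩)))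
    (fun n => (mJ n).piecewise (measurableSet_isKernel hf) measurable_const) ?_
  refine tendsto_pi_nhds.2 fun u => ?_
  by_cases hu : IsKernel (meanKernel f u)
  · have hK : u ∈ K := hu
    simp only [Set.piecewise_eq_of_mem _ _ _ hK]
    have e : ∀ n, J n u = ∫ ω, F (truncGraphon n (seedArray f u (vertexEdge U ω))) ∂P := fun n =>
      integral_map mve.aemeasurable
        ((mA n).comp (measurable_prodMk_left (x := u))).aestronglyMeasurable
    have lim := tendsto_integral_of_dominated_convergence (μ := P) (fun _ => (1 : ℝ))
      (F := fun n ω => F (truncGraphon n (seedArray f u (vertexEdge U ω))))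
      (f := fun _ => F (graphonOf (meanKernel f u)))
      (fun n => ((mA n).comp ((measurable_prodMk_left (x := u)).comp mve)).aestronglyMeasurable)
      (integrable_const _) (fun n => ae_of_all _ fun ω => hb _)
      ((ae_tendsto_dist_seedArray hf hU hu).mono fun ω hω =>
        (hF.tendsto _).comp (tendsto_iff_dist_tendsto_zero.2 hω))
    simp only [integral_const, probReal_univ, smul_eq_mul, one_mul] at lim
    exact lim.congr fun n => (e n).symm
  · have hK : u ∉ K := hu
    simp only [Set.piecewise_eq_of_notMem _ _ _ hK, graphonOf_of_not hu]
    exact tendsto_const_nhds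

theorem measurable_graphonOf_meanKernel
    (hf : Measurable fun q : I × I × I × I => f q.1 q.2.1 q.2.2.1 q.2.2.2)
    (hU : IsIIDUniform P U) : Measurable fun u => graphonOf (meanKernel f u) := by
  refine measurable_of_isClosed fun F hF => ?_
  -- A nonempty closed set is the zero set of the truncated distance to it. The empty set is
  -- separate because `Metric.infDist` to it is `0`.
  rcases F.eq_empty_or_nonempty with rfl | hne
  · simp
  have hm := measurable_comp_graphonOf_meanKernel hf hU
    (F := fun x => min 1 (Metric.infDist x F)) (by fun_prop) (fun x => by
      rw [abs_of_nonneg (le_min zero_le_one Metric.infDist_nonneg)]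
      exact min_le_left _ _)
  have : (fun u => graphonOf (meanKernel f u)) ⁻¹' F =
      (fun u => min 1 (Metric.infDist (graphonOf (meanKernel f u)) F)) ⁻¹' {0} := by
    ext u
    simp only [Set.mem_preimage, Set.mem_singleton_iff, hF.mem_iff_infDist_zero hne]
    constructor
    · intro h
      rw [h]
      norm_num
    · intro h
      rcases min_choice 1 (Metric.infDist (graphonOf (meanKernel f u)) F) with h' | h'
      · rw [h'] at h
        exact absurd h one_ne_zero
      · rw [← h', h]
  rw [this]
  exact hm (measurableSet_singleton 0)

variable {ζ : Pair → Ω → Set.Icc (-1 : ℝ) 1}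

/-- The two expressions for the single entry `ζ_{0,1}` agree almost surely, hence `f u x y v = f u y
x v` almost everywhere on the cube. Integrating over `v` makes `g_u` symmetric for almost every `u`.
-/
theorem ae_isKernel_meanKernel (hf : IsDirectedBy P ζ f U) :
    ∀ᵐ u : I, IsKernel (meanKernel f u) := by
  have hm := hf.measurable
  have mp := hf.iid.measurePreserving_root_pair_edge ⟨(0, 1), one_pos⟩
  have hs : MeasurableSet {q : I × (I × I) × I |
      f q.1 q.2.1.1 q.2.1.2 q.2.2 = f q.1 q.2.1.2 q.2.1.1 q.2.2} :=
    measurableSet_eq_fun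
      (hm.comp (f := fun q : I × (I × I) × I => (q.1, q.2.1.1, q.2.1.2, q.2.2)) (by fun_prop))
      (hm.comp (f := fun q : I × (I × I) × I => (q.1, q.2.1.2, q.2.1.1, q.2.2)) (by fun_prop))
  have h : ∀ᵐ q : I × (I × I) × I, f q.1 q.2.1.1 q.2.1.2 q.2.2 = f q.1 q.2.1.2 q.2.1.1 q.2.2 := by
    rw [← mp.map_eq, ae_map_iff mp.measurable.aemeasurable hs]
    filter_upwards [hf.eq ⟨(0, 1), one_pos⟩, hf.eq_swap ⟨(0, 1), one_pos⟩] with ω h₁ h₂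
    exact h₁.symm.trans h₂
  filter_upwards [Measure.ae_ae_of_ae_prod h] with u hu
  rw [isKernel_meanKernel_iff hm]
  filter_upwards [Measure.ae_ae_of_ae_prod hu] with p hp
  exact integral_congr_ae (hp.mono fun v hv => congrArg Subtype.val hv)

/-- A Carathéodory function is jointly measurable. Applied to the distance from a truncation to
`[g_u]`, this relies on separability of the space of arrays and not on that of the space of
graphons. -/
theorem measurable_of_continuous_left {D : (Pair → Set.Icc (-1 : ℝ) 1) → I → ℝ}
    (hc : ∀ u, Continuous fun z => D z u) (hm : ∀ z, Measurable (D z)) :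
    Measurable fun q : I × (Pair → Set.Icc (-1 : ℝ) 1) => D q.2 q.1 :=
  (measurable_uncurry_of_continuous_of_measurable hc hm).comp measurable_swap

theorem measurable_dist_truncGraphon {Φ : I → Graphon} (hΦ : Measurable Φ) (n : ℕ) :
    Measurable fun q : I × (Pair → Set.Icc (-1 : ℝ) 1) => dist (truncGraphon n q.2) (Φ q.1) := by
  refine measurable_of_continuous_left (D := fun z u => dist (truncGraphon n z) (Φ u))
    (fun u => (continuous_truncGraphon n).dist continuous_const) fun z => ?_
  have h : Continuous fun y : Graphon => dist (truncGraphon n z) y :=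
    continuous_const.dist continuous_id
  exact h.measurable.comp hΦ

/-- The pairs of a root variable and an array such that the truncations of the array converge to
the graphon of the root variable. -/
theorem measurableSet_tendsto_truncGraphon (hf : IsDirectedBy P ζ f U) :
    MeasurableSet {q : I × (Pair → Set.Icc (-1 : ℝ) 1) |
      Tendsto (fun n : ℕ => dist (truncGraphon n q.2) (graphonOf (meanKernel f q.1)))
        atTop (𝓝 0)} :=
  measurableSet_tendsto (𝓝 0) fun n =>
    measurable_dist_truncGraphon (measurable_graphonOf_meanKernel hf.measurable hf.iid) n

/-- The root is independent of the vertex and edge variables, so the convergence for almost every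
fixed `u` integrates to convergence at the random root. -/
theorem ae_tendsto_dist_truncGraphon (hf : IsDirectedBy P ζ f U) :
    ∀ᵐ ω ∂P, Tendsto (fun n : ℕ => dist (truncGraphon n fun p => ζ p ω)
      (graphonOf (meanKernel f (U .root ω)))) atTop (𝓝 0) := by
  have hG := measurableSet_tendsto_truncGraphon hf
  have mve := hf.iid.measurable_vertexEdge
  have mS : Measurable fun q : I × (ℕ → I) × (Pair → I) => (q.1, seedArray f q.1 q.2) :=
    measurable_fst.prodMk (measurable_seedArray hf.measurable)
  have h₁ : ∀ᵐ q ∂(volume : Measure I).prod (P.map (vertexEdge U)),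
      Tendsto (fun n : ℕ => dist (truncGraphon n (seedArray f q.1 q.2))
        (graphonOf (meanKernel f q.1))) atTop (𝓝 0) := by
    have := Measure.isProbabilityMeasure_map (μ := P) mve.aemeasurable
    refine (Measure.ae_prod_mem_iff_ae_ae_mem (mS hG)).2 ?_
    filter_upwards [ae_isKernel_meanKernel hf] with u hu
    refine (ae_map_iff mve.aemeasurable ((mS.comp (measurable_prodMk_left (x := u))) hG)).2 ?_
    exact ae_tendsto_dist_seedArray hf.measurable hf.iid hu
  rw [← hf.iid.map_root_vertexEdge] at h₁
  filter_upwards [ae_of_ae_map ((hf.iid.measurable _).prodMk mve).aemeasurable h₁,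
    ae_all_iff.2 hf.eq] with ω hω hζ
  have : (fun p => ζ p ω) = seedArray f (U .root ω) (vertexEdge U ω) := funext hζ
  rw [this]
  exact hω

/-- Almost sure convergence gives convergence in law. The left side involves only the law of `ζ`, so
the limit law cannot depend on the representation. -/
theorem tendsto_lintegral_truncGraphon (hζ : ∀ p, Measurable (ζ p)) (hf : IsDirectedBy P ζ f U)
    (F : BoundedContinuousFunction Graphon NNReal) :
    Tendsto (fun n : ℕ => ∫⁻ z, F (truncGraphon n z) ∂(P.map fun ω p => ζ p ω)) atTop
      (𝓝 (∫⁻ x, F x ∂(P.map fun ω => graphonOf (meanKernel f (U .root ω))))) := by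
  have mζ : Measurable fun ω p => ζ p ω := measurable_pi_lambda _ hζ
  have mF : Measurable fun x => (F x : ENNReal) := measurable_coe_nnreal_ennreal.comp
    F.continuous.measurable
  have mΦ : Measurable fun ω => graphonOf (meanKernel f (U .root ω)) :=
    (measurable_graphonOf_meanKernel hf.measurable hf.iid).comp (hf.iid.measurable _)
  have mT : ∀ n, Measurable fun z => (F (truncGraphon n z) : ENNReal) := fun n =>
    mF.comp (continuous_truncGraphon n).measurable
  rw [lintegral_map mF mΦ]
  simp_rw [lintegral_map (mT _) mζ]
  refine tendsto_lintegral_of_dominated_convergence (fun _ => ENNReal.ofNNReal (nndist F 0))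
    (fun n => (mT n).comp mζ) (fun n => ae_of_all _ fun ω => ?_) ?_ ?_
  · exact ENNReal.coe_le_coe.2 (BoundedContinuousFunction.NNReal.upper_bound F _)
  · simp
  · filter_upwards [ae_tendsto_dist_truncGraphon hf] with ω hω
    exact (ENNReal.continuous_coe.comp F.continuous).tendsto _ |>.comp
      (tendsto_iff_dist_tendsto_zero.2 hω)

theorem map_graphonOf_eq {Ω' : Type*} [MeasurableSpace Ω'] {P' : Measure Ω'}
    [IsProbabilityMeasure P'] {ζ' : Pair → Ω' → Set.Icc (-1 : ℝ) 1}
    {f' : I → I → I → I → Set.Icc (-1 : ℝ) 1} {U' : Seed → Ω' → I}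
    (hζ : ∀ p, Measurable (ζ p)) (hf : IsDirectedBy P ζ f U)
    (hζ' : ∀ p, Measurable (ζ' p)) (hf' : IsDirectedBy P' ζ' f' U')
    (h : P'.map (fun ω p => ζ' p ω) = P.map (fun ω p => ζ p ω)) :
    P'.map (fun ω => graphonOf (meanKernel f' (U' .root ω))) =
      P.map (fun ω => graphonOf (meanKernel f (U .root ω))) := by
  refine ext_of_forall_lintegral_eq_of_IsFiniteMeasure fun F => ?_
  have h₁ := tendsto_lintegral_truncGraphon hζ hf F
  have h₂ := tendsto_lintegral_truncGraphon hζ' hf' F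
  rw [h] at h₂
  exact tendsto_nhds_unique h₂ h₁

end Representation

end RandomGraphon

theorem mainTheorem8 {Ω : Type*} [MeasurableSpace Ω] (P : Measure Ω) [IsProbabilityMeasure P]
    (ζ : Pair → Ω → Set.Icc (-1 : ℝ) 1) (hζ : IsExchangeableArray P ζ)
    (f : I → I → I → I → Set.Icc (-1 : ℝ) 1) (U : Seed → Ω → I)
    (hf : IsDirectedBy P ζ f U) :
    -- `g_u` is a kernel for almost every `u`
    (∀ᵐ u : I, IsKernel (meanKernel f u)) ∧
    -- convergence of the arrays `f(u, U_i, U_j, U_{i,j})` with `u` fixed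
    (∀ u : I, IsKernel (meanKernel f u) → ∀ᵐ ω ∂P,
      Tendsto (fun n : ℕ => dist
        (truncGraphon n fun p =>
          f u (U (.vertex p.1.1) ω) (U (.vertex p.1.2) ω) (U (.edge p) ω))
        (graphonOf (meanKernel f u))) atTop (𝓝 0)) ∧
    -- almost sure convergence under the conditional law of `ζ` given `U = u`
    (∀ᵐ u : I, ∀ᵐ z ∂(condDistrib (fun ω p => ζ p ω) (U .root) P u),
      Tendsto (fun n : ℕ => dist (truncGraphon n z) (graphonOf (meanKernel f u)))
        atTop (𝓝 0)) ∧
    -- `[g_U]` is a random graphon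
    Measurable (fun ω => graphonOf (meanKernel f (U .root ω))) ∧
    -- its law is the same for every representation of an array with the law of `ζ`
    (∀ {Ω' : Type*} [MeasurableSpace Ω'] (P' : Measure Ω') [IsProbabilityMeasure P']
      (ζ' : Pair → Ω' → Set.Icc (-1 : ℝ) 1) (f' : I → I → I → I → Set.Icc (-1 : ℝ) 1)
      (U' : Seed → Ω' → I),
      IsExchangeableArray P' ζ' → IsDirectedBy P' ζ' f' U' →
      P'.map (fun ω p => ζ' p ω) = P.map (fun ω p => ζ p ω) →
      P'.map (fun ω => graphonOf (meanKernel f' (U' .root ω))) =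
        P.map (fun ω => graphonOf (meanKernel f (U .root ω)))) := by
  have hm : Measurable fun ω p => ζ p ω := measurable_pi_lambda _ hζ.measurable
  refine ⟨ae_isKernel_meanKernel hf, fun u hu => ae_tendsto_dist_seedArray hf.measurable hf.iid hu,
    ?_, ?_, ?_⟩
  · have hG := measurableSet_tendsto_truncGraphon hf
    have hR := hf.iid.measurable .root
    have h : ∀ᵐ q ∂(P.map fun ω => (U .root ω, fun p => ζ p ω)),
        Tendsto (fun n : ℕ => dist (truncGraphon n q.2) (graphonOf (meanKernel f q.1)))
          atTop (𝓝 0) :=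
      (ae_map_iff (hR.prodMk hm).aemeasurable hG).2 (ae_tendsto_dist_truncGraphon hf)
    -- The joint law of the root and the array is disintegrated over the uniform root.
    rw [← compProd_map_condDistrib hm.aemeasurable, hf.iid.uniform] at h
    exact Measure.ae_ae_of_ae_compProd h
  · exact (measurable_graphonOf_meanKernel hf.measurable hf.iid).comp (hf.iid.measurable _)
  · intro Ω' _ P' _ ζ' f' U' hζ' hf' h
    exact map_graphonOf_eq hζ.measurable hf hζ'.measurable hf' h
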